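/- Let $d\ge 1$. Let $\Gamma_0$ be the set of finite subsets of $\mathbb R^d$, with the Borel $\sigma$-algebra obtained from the identification of $\Gamma^{(n)}=\{\eta\in\Gamma_0:|\eta|=n\}$ with $\{(x_1,\dots,x_n)\in(\mathbb R^d)^n: x_i\ne x_j \text{ for } i\neq j\}/S_n$, and let $\Gamma_0^2=\{(\eta^+,\eta^-)\in\Gamma_0\times\Gamma_0:\eta^+\cap\eta^-=\emptyset\}$. Let $\lambda=\sum_{n\ge0}\frac1{n!}m^{(n)}$ be the Lebesgue--Poisson measure on $\Gamma_0$, where $m^{(n)}$ is the image of $dx_1\cdots dx_n$ on $\Gamma^{(n)}$ and $m^{(0)}(\{\emptyset\})=1$, and let $\lambda^2=\lambda\otimes\lambda$ on $\Gamma_0^2$. Let $d^\pm,b^\pm:\mathbb R^d\times\Gamma_0^2\to[0,\infty)$ be measurable functions such that $d^\pm(\cdot,\eta^+,\eta^-),\,b^\pm(\cdot,\eta^+,\eta^-)\in L^1_{\rm loc}(\mathbb R^d)$ for all $(\eta^+,\eta^-)\in\Gamma_0^2$. Set $$D^\pm(x,\xi^+,\xi^-,\eta^+,\eta^-)=\sum_{\zeta^+\subset\eta^+}\sum_{\zeta^-\subset\eta^-}(-1)^{|\eta^+\setminus\zeta^+|+|\eta^-\setminus\zeta^-|}\,d^\pm(x,\zeta^+\cup\xi^+,\zeta^-\cup\xi^-),$$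 and define $B^\pm$ in the same way from $b^\pm$. For $C>0$ let $\|G\|_{\mathcal L_C}=\int_{\Gamma_0^2}|G(\eta^+,\eta^-)|\,C^{|\eta^+|+|\eta^-|}\,d\lambda^2(\eta^+,\eta^-)$, and let $\mathcal K_C$ be the space of ($\lambda^2$-classes of) functions $k:\Gamma_0^2\to\mathbb R$ with $\|k\|_{\mathcal K_C}:=\|C^{-|\cdot^+|-|\cdot^-|}k\|_{L^\infty(\lambda^2)}<\infty$. Fix $C>0$ and let $N:\Gamma_0^2\to\mathbb R$ be a function that is $\lambda^2$-integrable over $\{(\eta^+,\eta^-)\in\Gamma_0^2:\eta^\pm\subset\Lambda,\ |\eta^+|=n,\ |\eta^-|=m\}$ for all $n,m\ge1$ and all bounded Borel sets $\Lambda\subset\mathbb R^d$, and such that for $\lambda^2$-a.a. $(\eta^+,\eta^-)$ $$\begin{aligned}&\sum_{x\in\eta^+}\Bigl(\|D^+(x,\eta^+\setminus x,\eta^-,\cdot,\cdot)\|_{\mathcal L_C}+\tfrac1C\|B^+(x,\eta^+\setminus x,\eta^-,\cdot,\cdot)\|_{\mathcal L_C}\Bigr)\\&+\sum_{y\in\eta^-}\Bigl(\|D^-(y,\eta^+,\eta^-\setminus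 y,\cdot,\cdot)\|_{\mathcal L_C}+\tfrac1C\|B^-(y,\eta^+,\eta^-\setminus y,\cdot,\cdot)\|_{\mathcal L_C}\Bigr)\le N(\eta^+,\eta^-)<\infty.\end{aligned}$$ Assume in addition that there are constants $A>0$, $M\in\mathbb N$, $\nu\ge1$ with $$N(\eta^+,\eta^-)\le A\,(1+|\eta^+|+|\eta^-|)^M\,\nu^{|\eta^+|+|\eta^-|}\qquad\text{for all }(\eta^+,\eta^-)\in\Gamma_0^2.$$ Then for every $\alpha\in(0,1/\nu)$ one has $\mathcal K_{\alpha C}\subset\mathcal K_C$, and the formula $$\begin{aligned}(\hat L^*k)(\eta^+,\eta^-)=&-\sum_{x\in\eta^+}\int_{\Gamma_0^2}k(\eta^+\cup\xi^+,\eta^-\cup\xi^-)\,D^+(x,\eta^+\setminus x,\eta^-,\xi^+,\xi^-)\,d\lambda^2(\xi^+,\xi^-)\\&+\sum_{x\in\eta^+}\int_{\Gamma_0^2}k((\eta^+\setminus x)\cup\xi^+,\eta^-\cup\xi^-)\,B^+(x,\eta^+\setminus x,\eta^-,\xi^+,\xi^-)\,d\lambda^2(\xi^+,\xi^-)\\&-\sum_{y\in\eta^-}\int_{\Gamma_0^2}k(\eta^+\cup\xi^+,\eta^-\cup\xi^-)\,D^-(y,\eta^+,\eta^-\setminus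 y,\xi^+,\xi^-)\,d\lambda^2(\xi^+,\xi^-)\\&+\sum_{y\in\eta^-}\int_{\Gamma_0^2}k(\eta^+\cup\xi^+,(\eta^-\setminus y)\cup\xi^-)\,B^-(y,\eta^+,\eta^-\setminus y,\xi^+,\xi^-)\,d\lambda^2(\xi^+,\xi^-)\end{aligned}$$ defines a linear operator $\hat L^*$ in $\mathcal K_C$ with domain $\mathcal K_{\alpha C}$: for every $k\in\mathcal K_{\alpha C}$ all the integrals converge absolutely for $\lambda^2$-a.a. $(\eta^+,\eta^-)\in\Gamma_0^2$, the result belongs to $\mathcal K_C$ and depends, up to $\lambda^2$-a.e. equality, only on the $\lambda^2$-class of $k$ and linearly on it. Moreover, $$\|\hat L^*k\|_{\mathcal K_C}\le\frac{A}{\alpha}\cdot\frac1{\alpha\nu}\left(\frac{M}{-e\ln(\alpha\nu)}\right)^M\|k\|_{\mathcal K_{\alpha C}}.$$ -/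

import Mathlib

open MeasureTheory Set
open scoped ENNReal

noncomputable section

namespace TwoComp

/-- The position space `ℝ^d`. -/
abbrev Pos (d : ℕ) : Type := EuclideanSpace ℝ (Fin d)

/-- The space `Γ₀` of finite configurations: all finite subsets of `ℝ^d`. -/
abbrev Conf (d : ℕ) : Type := Finset (Pos d)

/-- The `n`-tuples of pairwise distinct points of `ℝ^d`. -/
abbrev Tuple (d n : ℕ) : Type := {x : Fin n → Pos d // Function.Injective x}

open scoped Classical in
/-- The map `(x₁,…,xₙ) ↦ {x₁,…,xₙ}` from tuples of distinct points onto the `n`-point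
configurations. -/
def toConf (d n : ℕ) (x : Tuple d n) : Conf d := Finset.univ.image x.1

/-- The Borel σ-algebra of `Γ₀ = ⨆ₙ Γ⁽ⁿ⁾`, where `Γ⁽ⁿ⁾` is the quotient of the space of `n`-tuples
of distinct points by the symmetric group: `S` is measurable iff, for every `n`, the set of tuples
`(x₁,…,xₙ)` of distinct points with `{x₁,…,xₙ} ∈ S` is Borel. (The quotient maps are open with
finite fibres, so the quotient σ-algebra and the Borel σ-algebra of the quotient coincide.) -/
instance confMeasurableSpace (d : ℕ) : MeasurableSpace (Conf d) :=
  ⨅ n : ℕ, MeasurableSpace.map (toConf d n) inferInstance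

/-- The measure `m⁽ⁿ⁾`: image of `dx₁⋯dxₙ` on tuples of distinct points. -/
def confMeasure (d n : ℕ) : Measure (Conf d) :=
  Measure.map (toConf d n) (Measure.comap Subtype.val (volume : Measure (Fin n → Pos d)))

/-- The Lebesgue–Poisson measure `λ_z = ∑ₙ zⁿ/n! m⁽ⁿ⁾` on `Γ₀`. -/
def lebesguePoisson (d : ℕ) (z : ℝ) : Measure (Conf d) :=
  Measure.sum fun n : ℕ => ENNReal.ofReal (z ^ n / n.factorial) • confMeasure d n

/-- The space `Γ₀²` of pairs `(η⁺, η⁻)` of disjoint finite configurations, with the σ-algebra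
induced by the product. -/
abbrev Conf2 (d : ℕ) : Type := {η : Conf d × Conf d // Disjoint η.1 η.2}

variable {d : ℕ}

/-- The `+`-component `η⁺`. -/
abbrev Conf2.plus (η : Conf2 d) : Conf d := η.1.1

/-- The `-`-component `η⁻`. -/
abbrev Conf2.minus (η : Conf2 d) : Conf d := η.1.2

/-- The total number of points `|η⁺| + |η⁻|`. -/
def Conf2.size (η : Conf2 d) : ℕ := η.plus.card + η.minus.card

open scoped Classical in
/-- `(η⁺ \ x, η⁻)`. -/
def Conf2.erasePlus (η : Conf2 d) (x : Pos d) : Conf2 d :=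
  ⟨(η.plus.erase x, η.minus), η.2.mono_left (Finset.erase_subset x η.plus)⟩

open scoped Classical in
/-- `(η⁺, η⁻ \ y)`. -/
def Conf2.eraseMinus (η : Conf2 d) (y : Pos d) : Conf2 d :=
  ⟨(η.plus, η.minus.erase y), η.2.mono_right (Finset.erase_subset y η.minus)⟩

/-- The measure `λ² = λ₁ ⊗ λ₁`, restricted to `Γ₀²`. -/
def lambda2 (d : ℕ) : Measure (Conf2 d) :=
  Measure.comap Subtype.val ((lebesguePoisson d 1).prod (lebesguePoisson d 1))

open scoped Classical in
/-- `F(a, b)` for a function `F` on `Γ₀²`. The value `0` for pairs `(a, b)` that are not disjoint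
is only a convention. -/
def evalPair (F : Conf2 d → ℝ) (a b : Conf d) : ℝ :=
  if h : Disjoint a b then F ⟨(a, b), h⟩ else 0

open scoped Classical in
/-- `F(η⁺ ∪ ξ⁺, η⁻ ∪ ξ⁻)`. For `d ≥ 1` and fixed `η`, the two unions are disjoint for
`λ²`-almost all `ξ`. -/
def evalUnion (F : Conf2 d → ℝ) (η ξ : Conf2 d) : ℝ :=
  evalPair F (η.plus ∪ ξ.plus) (η.minus ∪ ξ.minus)

/-- The inverse `𝕂`-transform
`(𝕂⁻¹F)(η) = ∑_{ξ⁺ ⊆ η⁺} ∑_{ξ⁻ ⊆ η⁻} (-1)^{|η⁺ \ ξ⁺| + |η⁻ \ ξ⁻|} F(ξ⁺, ξ⁻)`. -/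
def KInv (F : Conf2 d → ℝ) (η : Conf2 d) : ℝ :=
  ∑ a ∈ η.plus.powerset, ∑ b ∈ η.minus.powerset,
    (-1 : ℝ) ^ ((η.plus.card - a.card) + (η.minus.card - b.card)) * evalPair F a b

/-- For a rate `r`, the function `R(x, ξ⁺, ξ⁻, η⁺, η⁻) = (𝕂⁻¹ r(x, · ∪ ξ⁺, · ∪ ξ⁻))(η⁺, η⁻)`.
For `r = d^±, b^±` these are the functions `D^±, B^±`. -/
def rateKernel (r : Pos d → Conf2 d → ℝ) (x : Pos d) (ξ η : Conf2 d) : ℝ :=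
  KInv (fun ζ => evalUnion (r x) ζ ξ) η

/-- The standing assumptions on a birth or death rate. -/
structure IsRate (r : Pos d → Conf2 d → ℝ) : Prop where
  nonneg : ∀ x η, 0 ≤ r x η
  measurable : Measurable fun p : Pos d × Conf2 d => r p.1 p.2
  locallyIntegrable : ∀ η, LocallyIntegrable (fun x => r x η) volume

/-- The norm `∫ |G(η)| C^{|η⁺|+|η⁻|} dλ²(η)` of `ℒ_C`, with values in `[0, ∞]`. -/
def normL (C : ℝ) (G : Conf2 d → ℝ) : ℝ≥0∞ :=
  ∫⁻ η, ENNReal.ofReal (|G η| * C ^ η.size) ∂lambda2 d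

/-- The set `Γ_Λ^{(n,m)}` of pairs in `Γ₀²` with `η⁺, η⁻ ⊆ Λ`, `|η⁺| = n`, `|η⁻| = m`. -/
def confIn (Λ : Set (Pos d)) (n m : ℕ) : Set (Conf2 d) :=
  {η | (η.plus : Set (Pos d)) ⊆ Λ ∧ (η.minus : Set (Pos d)) ⊆ Λ ∧
    η.plus.card = n ∧ η.minus.card = m}

/-- The left-hand side of the integrability condition on the rates at `η`, with values
in `[0, ∞]`. -/
def rateSum (C : ℝ) (dP bP dM bM : Pos d → Conf2 d → ℝ) (η : Conf2 d) : ℝ≥0∞ :=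
  (∑ x ∈ η.plus, normL C (rateKernel dP x (η.erasePlus x)))
    + ENNReal.ofReal (1 / C) * (∑ x ∈ η.plus, normL C (rateKernel bP x (η.erasePlus x)))
    + (∑ y ∈ η.minus, normL C (rateKernel dM y (η.eraseMinus y)))
    + ENNReal.ofReal (1 / C) * (∑ y ∈ η.minus, normL C (rateKernel bM y (η.eraseMinus y)))

/-- `C^{-|η⁺|-|η⁻|} k(η)`. -/
def weighted (C : ℝ) (k : Conf2 d → ℝ) (η : Conf2 d) : ℝ := (C ^ η.size)⁻¹ * k η

/-- The space `𝒦_C` of (`λ²`-classes of) functions `k` on `Γ₀²` with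
`C^{-|·⁺|-|·⁻|} k ∈ L^∞(Γ₀², λ²)`. -/
def KSpace (d : ℕ) (C : ℝ) : Submodule ℝ (Conf2 d →ₘ[lambda2 d] ℝ) where
  carrier := {k | MemLp (weighted C k) ∞ (lambda2 d)}
  zero_mem' := by
    refine MemLp.ae_eq ?_ (MemLp.zero (ε := ℝ))
    filter_upwards [AEEqFun.coeFn_zero (α := Conf2 d) (β := ℝ) (μ := lambda2 d)] with η h
    simp [weighted, h]
  add_mem' := by
    intro k l hk hl
    refine MemLp.ae_eq ?_ (MemLp.add hk hl)
    filter_upwards [AEEqFun.coeFn_add k l] with η h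
    simp [weighted, h, mul_add]
  smul_mem' := by
    intro c k hk
    refine MemLp.ae_eq ?_ (MemLp.const_smul hk c)
    filter_upwards [AEEqFun.coeFn_smul c k] with η h
    simp [weighted, h, mul_left_comm]

/-- The norm `‖C^{-|·⁺|-|·⁻|} k‖_{L^∞(λ²)}` of `k ∈ 𝒦_C`. -/
def normK {C : ℝ} (k : KSpace d C) : ℝ :=
  (eLpNorm (weighted C (k : Conf2 d →ₘ[lambda2 d] ℝ)) ∞ (lambda2 d)).toReal

/-- The explicit formula for `(L̂*k)(η)`. -/
def LStar (dP bP dM bM : Pos d → Conf2 d → ℝ) (k : Conf2 d → ℝ) (η : Conf2 d) : ℝ :=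
  - (∑ x ∈ η.plus, ∫ ξ, evalUnion k η ξ * rateKernel dP x (η.erasePlus x) ξ ∂lambda2 d)
  + (∑ x ∈ η.plus,
      ∫ ξ, evalUnion k (η.erasePlus x) ξ * rateKernel bP x (η.erasePlus x) ξ ∂lambda2 d)
  - (∑ y ∈ η.minus, ∫ ξ, evalUnion k η ξ * rateKernel dM y (η.eraseMinus y) ξ ∂lambda2 d)
  + (∑ y ∈ η.minus,
      ∫ ξ, evalUnion k (η.eraseMinus y) ξ * rateKernel bM y (η.eraseMinus y) ξ ∂lambda2 d)

/-- The formula for `L̂*k` is well-defined at `η`: every integral in it converges absolutely. -/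
def LStarDefinedAt (dP bP dM bM : Pos d → Conf2 d → ℝ) (k : Conf2 d → ℝ) (η : Conf2 d) : Prop :=
  (∀ x ∈ η.plus,
    Integrable (fun ξ => evalUnion k η ξ * rateKernel dP x (η.erasePlus x) ξ) (lambda2 d) ∧
    Integrable (fun ξ => evalUnion k (η.erasePlus x) ξ * rateKernel bP x (η.erasePlus x) ξ)
      (lambda2 d)) ∧
  (∀ y ∈ η.minus,
    Integrable (fun ξ => evalUnion k η ξ * rateKernel dM y (η.eraseMinus y) ξ) (lambda2 d) ∧
    Integrable (fun ξ => evalUnion k (η.eraseMinus y) ξ * rateKernel bM y (η.eraseMinus y) ξ)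
      (lambda2 d))

end TwoComp

end

/-! The estimate is pointwise. If |k(η)| ≤ K(αC)^|η|, with |η| the total number of points, then |k(η
∪ ξ)| ≤ K(αC)^|η| C^|ξ|, because α ≤ 1 and almost every ξ is componentwise disjoint from η. Each
integral is therefore at most K(αC)^|η| times the ℒ_C-norm of its kernel. In the birth terms a point
has been removed from η, which costs a factor 1/(αC); the weight 1/C in the condition on N absorbs
all of it but 1/α. Hence |L̂*k| ≤ (K/α)(αC)^n N(η) for n = |η| (`LStarDefinedAt_and_abs_LStar_le`).
After division by C^n, the growth bound leaves (1+n)^M (αν)^n, and maximizing t^M q^t at q = αν, t =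
n + 1 gives the constant (`one_add_pow_mul_pow_le`).

The longer part of the work makes this meaningful for classes of functions. A null set must not be
seen by k(η ∪ ξ) or k((η \ x) ∪ ξ) for almost all η and ξ. On tuples of points, union is
concatenation and removal of a point is a coordinate projection, and both respect Lebesgue null
sets; since d ≥ 1, coincidences of points are negligible (`ae_ae_union_lambda2`,
`ae_forall_erasePlus`, `ae_forall_eraseMinus`). Fubini arguments and the measurability of L̂*k need
joint measurability in several configurations. It is checked on tuples with the help of a measurable
enumeration of the points of a configuration (`measurable_prod_conf`). -/

noncomputable section

namespace TwoComp

/-! ### Measurable sorting of tuples -/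

section Sorting

variable {E : Type*} [MeasurableSpace E] [LinearOrder E]

/-- The sorting permutation of a tuple depends measurably on the tuple. -/
theorem measurable_tupleSort (hle : MeasurableSet {p : E × E | p.1 ≤ p.2}) (n : ℕ) :
    Measurable[_, ⊤] (fun x : Fin n → E => Tuple.sort x) := by
  let : MeasurableSpace (Equiv.Perm (Fin n)) := ⊤
  refine measurable_to_countable' fun σ => ?_
  have hle' : ∀ i j : Fin n, MeasurableSet {x : Fin n → E | x i ≤ x j} := fun i j =>
    (show Measurable fun x : Fin n → E => (x i, x j) by fun_prop) hle
  have heq : ∀ i j : Fin n, MeasurableSet {x : Fin n → E | x i = x j} := fun i j => by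
    have : {x : Fin n → E | x i = x j} = {x | x i ≤ x j} ∩ {x | x j ≤ x i} := by
      ext x; exact le_antisymm_iff
    rw [this]; exact (hle' i j).inter (hle' j i)
  -- The sorting permutation is the one that makes the tuple monotone and keeps ties in index order:
  -- finitely many comparisons.
  have : (fun x : Fin n → E => Tuple.sort x) ⁻¹' {σ} =
      (⋂ i, ⋂ j, {x | i ≤ j → x (σ i) ≤ x (σ j)}) ∩
        ⋂ i, ⋂ j, {x | i < j → x (σ i) = x (σ j) → σ i < σ j} := by
    ext x
    simp only [mem_preimage, mem_singleton_iff, mem_inter_iff, mem_iInter, mem_ofPred_eq]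
    rw [eq_comm, Tuple.eq_sort_iff]
    rfl
  rw [this]
  refine .inter (.iInter fun i => .iInter fun j => ?_) (.iInter fun i => .iInter fun j => ?_)
  · exact (MeasurableSet.const _).imp (hle' _ _)
  · exact (MeasurableSet.const _).imp ((heq _ _).imp (.const _))

/-- Sorting a tuple is measurable. -/
theorem measurable_comp_tupleSort (hle : MeasurableSet {p : E × E | p.1 ≤ p.2}) (n : ℕ) :
    Measurable (fun x : Fin n → E => x ∘ Tuple.sort x) := by
  let : MeasurableSpace (Equiv.Perm (Fin n)) := ⊤
  refine measurable_pi_lambda _ fun i => ?_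
  have h : Measurable fun p : (Fin n → E) × Equiv.Perm (Fin n) => p.1 (p.2 i) :=
    measurable_from_prod_countable_left fun σ => measurable_pi_apply (σ i)
  exact h.comp (measurable_id.prodMk (measurable_tupleSort hle n))

end Sorting

variable {d : ℕ}

/-! ### Measurability on the configuration space -/

theorem measurable_toConf (d n : ℕ) : Measurable (toConf d n) :=
  measurable_iff_le_map.2 (iInf_le _ n)

theorem measurableSet_conf_iff {s : Set (Conf d)} :
    MeasurableSet s ↔ ∀ n, MeasurableSet (toConf d n ⁻¹' s) :=
  MeasurableSpace.measurableSet_iInf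

theorem measurable_conf_iff {β : Type*} [MeasurableSpace β] {f : Conf d → β} :
    Measurable f ↔ ∀ n, Measurable fun x => f (toConf d n x) := by
  refine ⟨fun h n => h.comp (measurable_toConf d n), fun h s hs => ?_⟩
  exact measurableSet_conf_iff.2 fun n => h n hs

theorem measurable_tuple_apply {X : Type*} [MeasurableSpace X] {n : ℕ} {f : X → Tuple d n}
    (hf : Measurable f) (i : Fin n) : Measurable fun p => (f p).1 i :=
  (measurable_pi_apply i).comp (measurable_subtype_coe.comp hf)

theorem mem_toConf {n : ℕ} {t : Tuple d n} {x : Pos d} : x ∈ toConf d n t ↔ ∃ i, t.1 i = x := by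
  simp [toConf]

theorem card_toConf {n : ℕ} (t : Tuple d n) : (toConf d n t).card = n := by
  simp [toConf, Finset.card_image_of_injective _ t.2]

theorem measurable_card : Measurable fun η : Conf d => η.card :=
  measurable_conf_iff.2 fun n => by simp only [card_toConf]; exact measurable_const

theorem measurableSet_injective (d n : ℕ) :
    MeasurableSet {x : Fin n → Pos d | Function.Injective x} := by
  have : {x : Fin n → Pos d | Function.Injective x} = ⋂ i, ⋂ j, {x | x i = x j → i = j} := by
    ext x; simp [Function.Injective]
  rw [this]
  refine .iInter fun i => .iInter fun j => ?_
  exact (measurableSet_eq_fun (measurable_pi_apply i) (measurable_pi_apply j)).imp (.const _)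

/-- The points of a configuration can be listed in a measurable way. -/
theorem exists_measurable_listing (d n : ℕ) : ∃ s : Conf d → Fin n → Pos d, Measurable s ∧
    ∀ η, η.card = n → ∃ h : Function.Injective (s η), toConf d n ⟨s η, h⟩ = η := by
  classical
  have he := measurableEmbedding_embeddingReal (Pos d)
  -- Any linear order with measurable graph will do; this one is pulled back from ℝ along a
  -- measurable embedding.
  let : LinearOrder (Pos d) := LinearOrder.lift' (embeddingReal (Pos d)) he.injective
  have hle : MeasurableSet {p : Pos d × Pos d | p.1 ≤ p.2} :=
    measurableSet_le (f := fun p : Pos d × Pos d => embeddingReal (Pos d) p.1)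
      (g := fun p => embeddingReal (Pos d) p.2) (he.measurable.comp measurable_fst) (he.measurable.comp measurable_snd)
  refine ⟨fun η => if h : η.card = n then η.orderEmbOfFin h else fun _ => 0, ?_, ?_⟩
  · refine measurable_conf_iff.2 fun m => ?_
    by_cases hmn : m = n
    · subst hmn
      have hs : ∀ t : Tuple d m, (if h : (toConf d m t).card = m then
          ((toConf d m t).orderEmbOfFin h : Fin m → Pos d) else fun _ => 0) =
          t.1 ∘ Tuple.sort t.1 := by
        intro t
        rw [dif_pos (card_toConf t)]
        refine (Finset.orderEmbOfFin_unique (card_toConf t) (fun i => ?_) ?_).symm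
        · exact mem_toConf.2 ⟨_, rfl⟩
        · exact (Tuple.monotone_sort t.1).strictMono_of_injective
            (t.2.comp (Tuple.sort t.1).injective)
      simp only [hs]
      exact (measurable_comp_tupleSort hle m).comp measurable_subtype_coe
    · simp only [card_toConf, hmn, dite_false]
      exact measurable_const
  · intro η h
    simp only [h, dite_true]
    refine ⟨(η.orderEmbOfFin h).injective, ?_⟩
    ext x
    rw [mem_toConf, ← Finset.mem_coe, ← Finset.range_orderEmbOfFin η h]
    rfl

/-- Joint measurability in a configuration and a further variable can be checked on tuples. -/
theorem measurable_prod_conf {X β : Type*} [MeasurableSpace X] [MeasurableSpace β]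
    {f : X × Conf d → β}
    (h : ∀ n, Measurable fun p : X × Tuple d n => f (p.1, toConf d n p.2)) : Measurable f := by
  intro S hS
  choose s hs hs' using exists_measurable_listing d
  -- A quotient σ-algebra need not commute with products. The measurable listing is a section of the
  -- quotient map on each level, so the preimage can be recovered from the set of tuples, which is
  -- measurable after embedding it into all of (ℝ^d)^n.
  have key : f ⁻¹' S = ⋃ n, (fun p : X × Conf d => p.2.card) ⁻¹' {n} ∩
      (fun p : X × Conf d => (p.1, s n p.2)) ⁻¹' ((Prod.map id Subtype.val) ''
        ((fun p : X × Tuple d n => f (p.1, toConf d n p.2)) ⁻¹' S)) := by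
    ext ⟨x, η⟩
    simp only [mem_preimage, mem_iUnion, mem_inter_iff, mem_singleton_iff, mem_image,
      Prod.exists, Prod.map_apply, Prod.mk.injEq, id]
    constructor
    · intro hx
      obtain ⟨hi, hη⟩ := hs' _ η rfl
      exact ⟨_, rfl, x, ⟨s _ η, hi⟩, by rwa [hη], rfl, rfl⟩
    · rintro ⟨n, hn, y, t, ht, rfl, hts⟩
      obtain ⟨hi, hη⟩ := hs' _ η hn
      have : t = ⟨s n η, hi⟩ := Subtype.ext hts
      rwa [this, hη] at ht
  rw [key]
  refine .iUnion fun n => .inter ?_ ?_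
  · exact (measurable_card.comp measurable_snd) (measurableSet_singleton n)
  · refine (measurable_fst.prodMk ((hs n).comp measurable_snd)) ?_
    refine (MeasurableEmbedding.prodMap .id
      (.subtype_coe (measurableSet_injective d n))).measurableSet_image.2 (h n hS)

theorem measurableSet_prod_conf {X : Type*} [MeasurableSpace X] {s : Set (X × Conf d)}
    (h : ∀ n, MeasurableSet {p : X × Tuple d n | (p.1, toConf d n p.2) ∈ s}) :
    MeasurableSet s := by
  refine measurable_mem.1 (measurable_prod_conf fun n => ?_)
  exact measurable_mem.2 (h n)

theorem measurableSet_mem : MeasurableSet {p : Pos d × Conf d | p.1 ∈ p.2} := by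
  refine measurableSet_prod_conf fun n => ?_
  simp only [mem_ofPred_eq, mem_toConf, ofPred_exists]
  exact .iUnion fun i => measurableSet_eq_fun (measurable_tuple_apply measurable_snd i) measurable_fst

theorem measurableSet_disjoint : MeasurableSet {p : Conf d × Conf d | Disjoint p.1 p.2} := by
  refine measurableSet_prod_conf fun n => ?_
  have : {p : Conf d × Tuple d n | (p.1, toConf d n p.2) ∈ {p : Conf d × Conf d | Disjoint p.1 p.2}}
      = ⋂ i, {p | (p.2.1 i, p.1) ∈ {p : Pos d × Conf d | p.1 ∈ p.2}ᶜ} := by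
    ext p
    simp only [mem_ofPred_eq, Finset.disjoint_right, mem_toConf, mem_iInter, mem_compl_iff]
    exact ⟨fun h i => h ⟨i, rfl⟩, fun h a ⟨i, hi⟩ => hi ▸ h i⟩
  rw [this]
  refine .iInter fun i => ?_
  exact ((measurable_tuple_apply measurable_snd i).prodMk measurable_fst) measurableSet_mem.compl

-- Unions, images and erasures below are built by repeated insertion. An already present point
-- leaves the tuple unchanged; a new one is prepended to it.
open scoped Classical in
theorem measurable_insert : Measurable fun p : Pos d × Conf d => insert p.1 p.2 := by
  refine measurable_prod_conf fun n => ?_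
  have hs : MeasurableSet {p : Pos d × Tuple d n | p.1 ∈ toConf d n p.2} :=
    (measurable_fst.prodMk ((measurable_toConf d n).comp measurable_snd)) measurableSet_mem
  refine measurable_of_restrict_of_restrict_compl hs ?_ ?_
  · have : ({p : Pos d × Tuple d n | p.1 ∈ toConf d n p.2}.domRestrict
        fun p => insert p.1 (toConf d n p.2)) = fun p => toConf d n p.1.2 := by
      funext p
      exact Finset.insert_eq_of_mem p.2
    rw [this]
    exact (measurable_toConf d n).comp (by fun_prop)
  · have hinj : ∀ p : ({p : Pos d × Tuple d n | p.1 ∈ toConf d n p.2}ᶜ : Set _),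
        Function.Injective (Fin.cons p.1.1 p.1.2.1 : Fin (n + 1) → Pos d) := by
      intro p
      refine Fin.cons_injective_iff.2 ⟨fun h => p.2 ?_, p.1.2.2⟩
      exact mem_toConf.2 h
    have : ({p : Pos d × Tuple d n | p.1 ∈ toConf d n p.2}ᶜ.domRestrict
        fun p => insert p.1 (toConf d n p.2)) =
        fun p => toConf d (n + 1) ⟨Fin.cons p.1.1 p.1.2.1, hinj p⟩ := by
      funext p
      ext x
      rw [mem_toConf]
      change x ∈ insert p.1.1 (toConf d n p.1.2) ↔ _
      simp [mem_toConf, Fin.exists_fin_succ, eq_comm]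
    rw [this]
    refine (measurable_toConf d (n + 1)).comp (Measurable.subtype_mk ?_)
    refine measurable_pi_lambda _ fun i => ?_
    refine Fin.cases ?_ (fun j => ?_) i
    · simp only [Fin.cons_zero]; fun_prop
    · simp only [Fin.cons_succ]
      exact measurable_tuple_apply (measurable_snd.comp measurable_subtype_coe) j

open scoped Classical in
theorem measurable_image {ι : Type*} (J : Finset ι) :
    Measurable fun x : ι → Pos d => J.image x := by
  induction J using Finset.induction with
  | empty => simp
  | insert i J _ ih =>
    simp only [Finset.image_insert]
    exact measurable_insert.comp ((measurable_pi_apply i).prodMk ih)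

open scoped Classical in
theorem measurable_union : Measurable fun p : Conf d × Conf d => p.1 ∪ p.2 := by
  refine measurable_prod_conf fun n => ?_
  have : ∀ J : Finset (Fin n), Measurable fun p : Conf d × Tuple d n => p.1 ∪ J.image p.2.1 := by
    intro J
    induction J using Finset.induction with
    | empty => simpa using measurable_fst
    | insert i J _ ih =>
      simp only [Finset.image_insert, Finset.union_insert]
      exact measurable_insert.comp ((measurable_tuple_apply measurable_snd i).prodMk ih)
  exact this Finset.univ

open scoped Classical in
theorem measurable_erase : Measurable fun p : Pos d × Conf d => p.2.erase p.1 := by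
  refine measurable_prod_conf fun n => ?_
  have : ∀ J : Finset (Fin n),
      Measurable fun p : Pos d × Tuple d n => (J.image p.2.1).erase p.1 := by
    intro J
    induction J using Finset.induction with
    | empty => simp
    | insert i J _ ih =>
      have : (fun p : Pos d × Tuple d n => ((insert i J).image p.2.1).erase p.1) = fun p =>
          if p.1 = p.2.1 i then (J.image p.2.1).erase p.1
          else insert (p.2.1 i) ((J.image p.2.1).erase p.1) := by
        funext p
        split_ifs with h
        · rw [Finset.image_insert, ← h, Finset.erase_insert_eq_erase]
        · rw [Finset.image_insert, Finset.erase_insert_of_ne (Ne.symm h)]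
      rw [this]
      refine Measurable.ite (measurableSet_eq_fun measurable_fst
        (measurable_tuple_apply measurable_snd i)) ih ?_
      exact measurable_insert.comp ((measurable_tuple_apply measurable_snd i).prodMk ih)
  exact this Finset.univ

/-- A sum over the points of a configuration is measurable. -/
theorem measurable_sum_mem {X : Type*} [MeasurableSpace X] {G : X × Pos d → ℝ}
    (hG : Measurable G) : Measurable fun p : X × Conf d => ∑ x ∈ p.2, G (p.1, x) := by
  classical
  refine measurable_prod_conf fun n => ?_
  have : ∀ p : X × Tuple d n, ∑ x ∈ toConf d n p.2, G (p.1, x) = ∑ i, G (p.1, p.2.1 i) :=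
    fun p => Finset.sum_image p.2.2.injOn
  simp only [this]
  exact Finset.measurable_sum _ fun i _ =>
    hG.comp (measurable_fst.prodMk (measurable_tuple_apply measurable_snd i))

/-- A sum over the subsets of a configuration is measurable. -/
theorem measurable_sum_powerset {X : Type*} [MeasurableSpace X] {G : (X × Conf d) × Conf d → ℝ}
    (hG : Measurable G) :
    Measurable fun p : X × Conf d => ∑ a ∈ p.2.powerset, G (p, a) := by
  classical
  refine measurable_prod_conf fun n => ?_
  have : ∀ p : X × Tuple d n, ∑ a ∈ (toConf d n p.2).powerset, G ((p.1, toConf d n p.2), a) =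
      ∑ J : Finset (Fin n), G ((p.1, toConf d n p.2), J.image p.2.1) := by
    intro p
    have h : (toConf d n p.2).powerset = (Finset.univ.powerset).image (Finset.image p.2.1) :=
      Finset.powerset_image ..
    rw [h, Finset.sum_image (Finset.image_injective p.2.2).injOn, Finset.powerset_univ]
  simp only [this]
  refine Finset.measurable_sum _ fun J _ => hG.comp ?_
  have h1 : Measurable fun p : X × Tuple d n => toConf d n p.2 :=
    (measurable_toConf d n).comp measurable_snd
  have h2 : Measurable fun p : X × Tuple d n => J.image p.2.1 :=
    (measurable_image J).comp (by fun_prop)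
  exact (measurable_fst.prodMk h1).prodMk h2

/-! ### Measurability on Γ₀² and of the kernels -/

theorem measurable_plus : Measurable fun η : Conf2 d => η.plus := by
  unfold Conf2.plus; fun_prop

theorem measurable_minus : Measurable fun η : Conf2 d => η.minus := by
  unfold Conf2.minus; fun_prop

theorem measurable_size : Measurable fun η : Conf2 d => η.size :=
  (measurable_card.comp measurable_plus).add (measurable_card.comp measurable_minus)

theorem measurable_erasePlus : Measurable fun p : Conf2 d × Pos d => p.1.erasePlus p.2 := by
  refine Measurable.subtype_mk (.prodMk ?_ (measurable_minus.comp measurable_fst))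
  exact measurable_erase.comp (measurable_snd.prodMk (measurable_plus.comp measurable_fst))

theorem measurable_eraseMinus : Measurable fun p : Conf2 d × Pos d => p.1.eraseMinus p.2 := by
  refine Measurable.subtype_mk (.prodMk (measurable_plus.comp measurable_fst) ?_)
  exact measurable_erase.comp (measurable_snd.prodMk (measurable_minus.comp measurable_fst))

/-- The parameter in `X` later carries the point x and the configuration ξ of a kernel, so that
joint measurability survives each construction. -/
theorem measurable_evalPair {X : Type*} [MeasurableSpace X] {F : X → Conf2 d → ℝ}
    (hF : Measurable fun p : X × Conf2 d => F p.1 p.2) :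
    Measurable fun p : X × Conf d × Conf d => evalPair (F p.1) p.2.1 p.2.2 := by
  classical
  have hs : MeasurableSet {p : X × Conf d × Conf d | Disjoint p.2.1 p.2.2} :=
    measurable_snd measurableSet_disjoint
  refine measurable_of_restrict_of_restrict_compl hs ?_ ?_
  · have : ({p : X × Conf d × Conf d | Disjoint p.2.1 p.2.2}.domRestrict
        fun p => evalPair (F p.1) p.2.1 p.2.2) = fun p => F p.1.1 ⟨p.1.2, p.2⟩ := by
      funext p
      exact dif_pos p.2
    rw [this]
    exact hF.comp (.prodMk (by fun_prop) (.subtype_mk (by fun_prop)))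
  · have : ({p : X × Conf d × Conf d | Disjoint p.2.1 p.2.2}ᶜ.domRestrict
        fun p => evalPair (F p.1) p.2.1 p.2.2) = fun _ => 0 := by
      funext p
      exact dif_neg p.2
    rw [this]
    exact measurable_const

theorem measurable_evalUnion {X : Type*} [MeasurableSpace X] {F : X → Conf2 d → ℝ}
    (hF : Measurable fun p : X × Conf2 d => F p.1 p.2) :
    Measurable fun p : X × Conf2 d × Conf2 d => evalUnion (F p.1) p.2.1 p.2.2 := by
  classical
  refine (measurable_evalPair hF).comp (measurable_fst.prodMk (.prodMk ?_ ?_))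
  · exact measurable_union.comp ((measurable_plus.comp (by fun_prop)).prodMk
      (measurable_plus.comp (by fun_prop)))
  · exact measurable_union.comp ((measurable_minus.comp (by fun_prop)).prodMk
      (measurable_minus.comp (by fun_prop)))

theorem measurable_KInv {X : Type*} [MeasurableSpace X] {F : X → Conf2 d → ℝ}
    (hF : Measurable fun p : X × Conf2 d => F p.1 p.2) :
    Measurable fun p : X × Conf2 d => KInv (F p.1) p.2 := by
  -- the summand, as a function of `((((x, η⁺), a), η⁻), b)`
  let G : (((X × Conf d) × Conf d) × Conf d) × Conf d → ℝ := fun q =>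
    (-1 : ℝ) ^ ((q.1.1.1.2.card - q.1.1.2.card) + (q.1.2.card - q.2.card)) *
      evalPair (F q.1.1.1.1) q.1.1.2 q.2
  have hG : Measurable G := by
    refine Measurable.mul ?_ ((measurable_evalPair hF).comp
      (f := fun q : (((X × Conf d) × Conf d) × Conf d) × Conf d =>
        (q.1.1.1.1, q.1.1.2, q.2)) (by fun_prop))
    refine (measurable_from_top (f := fun n : ℕ => (-1 : ℝ) ^ n)).comp ?_
    have h1 : Measurable fun q : (((X × Conf d) × Conf d) × Conf d) × Conf d =>
      q.1.1.1.2.card := measurable_card.comp (by fun_prop)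
    have h2 : Measurable fun q : (((X × Conf d) × Conf d) × Conf d) × Conf d =>
      q.1.1.2.card := measurable_card.comp (by fun_prop)
    have h3 : Measurable fun q : (((X × Conf d) × Conf d) × Conf d) × Conf d =>
      q.1.2.card := measurable_card.comp (by fun_prop)
    have h4 : Measurable fun q : (((X × Conf d) × Conf d) × Conf d) × Conf d =>
      q.2.card := measurable_card.comp (by fun_prop)
    exact (h1.sub h2).add (h3.sub h4)
  have h1 := measurable_sum_powerset hG
  -- the inner sum as a function of `(((x, η⁻), η⁺), a)`
  have h2 : Measurable fun q : ((X × Conf d) × Conf d) × Conf d =>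
      ∑ b ∈ q.1.1.2.powerset, G (((((q.1.1.1, q.1.2), q.2), q.1.1.2)), b) :=
    h1.comp (f := fun q : ((X × Conf d) × Conf d) × Conf d =>
      ((((q.1.1.1, q.1.2), q.2), q.1.1.2) : ((X × Conf d) × Conf d) × Conf d)) (by fun_prop)
  have h3 := measurable_sum_powerset h2
  exact h3.comp (f := fun p : X × Conf2 d => ((p.1, p.2.minus), p.2.plus))
    ((measurable_fst.prodMk (measurable_minus.comp measurable_snd)).prodMk
      (measurable_plus.comp measurable_snd))

/-- The kernel `(x, ξ, η) ↦ D^±(x, ξ, η)` is jointly measurable. -/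
theorem measurable_rateKernel {r : Pos d → Conf2 d → ℝ}
    (hr : Measurable fun p : Pos d × Conf2 d => r p.1 p.2) :
    Measurable fun p : Pos d × Conf2 d × Conf2 d => rateKernel r p.1 p.2.1 p.2.2 := by
  have h := measurable_KInv (X := Pos d × Conf2 d)
    (F := fun q ζ => evalUnion (r q.1) ζ q.2) ?_
  · exact h.comp (f := fun p : Pos d × Conf2 d × Conf2 d => ((p.1, p.2.1), p.2.2)) (by fun_prop)
  · exact (measurable_evalUnion hr).comp (f := fun p : (Pos d × Conf2 d) × Conf2 d =>
      (p.1.1, p.2, p.1.2)) (by fun_prop)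

/-! ### Null sets of the Lebesgue–Poisson measure -/

theorem sFinite_comap {α β : Type*} [MeasurableSpace α] [MeasurableSpace β] {f : α → β}
    (hf : MeasurableEmbedding f) (μ : Measure β) [SFinite μ] : SFinite (μ.comap f) := by
  refine ⟨fun n => (sfiniteSeq μ n).comap f, fun n => ⟨?_⟩, ?_⟩
  · rw [hf.comap_apply]; exact measure_lt_top _ _
  · ext s hs
    rw [Measure.sum_apply _ hs, hf.comap_apply]
    simp only [hf.comap_apply]
    rw [← Measure.sum_apply _ (hf.measurableSet_image.2 hs), sum_sfiniteSeq]

instance sFinite_confMeasure (d n : ℕ) : SFinite (confMeasure d n) := by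
  have : SFinite (Measure.comap Subtype.val (volume : Measure (Fin n → Pos d)) :
      Measure (Tuple d n)) := sFinite_comap (.subtype_coe (measurableSet_injective d n)) _
  unfold confMeasure
  infer_instance

instance sFinite_lebesguePoisson (d : ℕ) (z : ℝ) : SFinite (lebesguePoisson d z) := by
  unfold lebesguePoisson
  infer_instance

instance sFinite_lambda2 (d : ℕ) : SFinite (lambda2 d) :=
  sFinite_comap (.subtype_coe measurableSet_disjoint) _

/-- The weights 1/n! are nonzero, so null sets can be tested on each number of points separately. -/
theorem ae_lebesguePoisson_iff {P : Conf d → Prop} (hP : MeasurableSet {η | P η}) :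
    (∀ᵐ η ∂lebesguePoisson d 1, P η) ↔
      ∀ n, ∀ᵐ x : Fin n → Pos d, ∀ h : Function.Injective x, P (toConf d n ⟨x, h⟩) := by
  classical
  unfold lebesguePoisson
  rw [Measure.ae_sum_iff]
  refine forall_congr' fun n => ?_
  rw [Measure.ae_ennreal_smul_measure_iff (by simp; positivity), confMeasure,
    ae_map_iff (measurable_toConf d n).aemeasurable hP]
  have h := ae_restrict_iff_subtype (μ := (volume : Measure (Fin n → Pos d)))
    (measurableSet_injective d n)
    (p := fun x => ∀ h : Function.Injective x, P (toConf d n ⟨x, h⟩))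
  rw [ae_restrict_iff' (measurableSet_injective d n)] at h
  have h1 : (∀ᵐ x : Fin n → Pos d, x ∈ {x : Fin n → Pos d | Function.Injective x} →
      ∀ h : Function.Injective x, P (toConf d n ⟨x, h⟩)) ↔
      ∀ᵐ x : Fin n → Pos d, ∀ h : Function.Injective x, P (toConf d n ⟨x, h⟩) :=
    ⟨fun h => h.mono fun x hx hi => hx hi hi, fun h => h.mono fun x hx _ => hx⟩
  rw [← h1, h]
  refine ⟨fun h => h.mono fun x hx _ => hx, fun h => h.mono fun x hx => hx x.2⟩

theorem ae_injective (hd : 1 ≤ d) (ι : Type*) [Fintype ι] :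
    ∀ᵐ x : ι → Pos d, Function.Injective x := by
  classical
  have : Nonempty (Fin d) := ⟨⟨0, hd⟩⟩
  have hne : ∀ i j : ι, i ≠ j → ∀ᵐ x : ι → Pos d, x i ≠ x j := by
    intro i j hij
    -- The diagonal is a linear subspace, proper because d ≥ 1 provides a nonzero vector, hence
    -- Lebesgue null.
    let S : Submodule ℝ (ι → Pos d) := LinearMap.ker
      ((LinearMap.proj i : (ι → Pos d) →ₗ[ℝ] Pos d) - LinearMap.proj j)
    have hS : S ≠ ⊤ := by
      intro h
      obtain ⟨v, hv⟩ := exists_ne (0 : Pos d)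
      have : (Pi.single i v : ι → Pos d) ∈ S := h ▸ Submodule.mem_top
      simp [S, hv, Ne.symm hij] at this
    have := Measure.addHaar_submodule (volume : Measure (ι → Pos d)) S hS
    refine (measure_eq_zero_iff_ae_notMem.1 this).mono fun x hx h => hx ?_
    simp [S, h]
  have h : ∀ᵐ x : ι → Pos d, ∀ i j, i ≠ j → x i ≠ x j := by
    simp only [ae_all_iff]
    intro i j hij
    exact hne i j hij
  exact h.mono fun x hx i j => not_imp_not.1 (hx i j)

open scoped Classical in
/-- A property of almost all configurations holds for the set of points of almost every tuple. -/
theorem ae_image_of_ae {ι : Type*} [Fintype ι] (hd : 1 ≤ d) {P : Conf d → Prop} (hP : MeasurableSet {η | P η})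
    (h : ∀ᵐ η ∂lebesguePoisson d 1, P η) :
    ∀ᵐ x : ι → Pos d, P (Finset.univ.image x) := by
  have e := Fintype.equivFin ι
  have h1 : ∀ᵐ y : Fin (Fintype.card ι) → Pos d, P (Finset.univ.image y) := by
    filter_upwards [(ae_lebesguePoisson_iff hP).1 h _, ae_injective hd _] with y hy hi
    exact hy hi
  have h2 := (volume_measurePreserving_piCongrLeft (fun _ : Fin (Fintype.card ι) => Pos d)
    e).quasiMeasurePreserving.ae h1
  refine h2.mono fun x hx => ?_
  convert hx using 2
  ext z
  simp only [Finset.mem_image, Finset.mem_univ, true_and]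
  refine ⟨fun ⟨i, hi⟩ => ⟨e i, ?_⟩, fun ⟨j, hj⟩ => ⟨e.symm j, ?_⟩⟩
  · rw [← hi]
    exact Equiv.piCongrLeft_apply_apply (fun _ : Fin (Fintype.card ι) => Pos d) e x i
  · rw [← hj]
    obtain ⟨i, rfl⟩ := e.surjective j
    rw [e.symm_apply_apply]
    exact (Equiv.piCongrLeft_apply_apply (fun _ : Fin (Fintype.card ι) => Pos d) e x i).symm

theorem measurableSet_ae_right {X Y : Type*} [MeasurableSpace X] [MeasurableSpace Y]
    {μ : Measure Y} [SFinite μ] {P : X × Y → Prop} (hP : MeasurableSet {p | P p}) :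
    MeasurableSet {x | ∀ᵐ y ∂μ, P (x, y)} :=
  measurable_measure_prodMk_left hP.compl (measurableSet_singleton 0)

/-- A pair of tuples is one tuple indexed by a disjoint sum, and Lebesgue measure splits
accordingly; iterated statements thus reduce to a single tuple. -/
theorem ae_ae_lebesguePoisson_of_tuples (hd : 1 ≤ d) {Q : Conf d × Conf d → Prop}
    (hQ : MeasurableSet {p | Q p})
    (h : ∀ n m, ∀ᵐ z : Fin n ⊕ Fin m → Pos d, ∀ (_ : Function.Injective z)
      (h1 : Function.Injective fun i => z (.inl i)) (h2 : Function.Injective fun i => z (.inr i)),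
      Q (toConf d n ⟨_, h1⟩, toConf d m ⟨_, h2⟩)) :
    ∀ᵐ a ∂lebesguePoisson d 1, ∀ᵐ b ∂lebesguePoisson d 1, Q (a, b) := by
  rw [ae_lebesguePoisson_iff (measurableSet_ae_right hQ)]
  intro n
  have h' : ∀ m, ∀ᵐ x : Fin n → Pos d, ∀ᵐ y : Fin m → Pos d,
      ∀ (h1 : Function.Injective x) (h2 : Function.Injective y),
        Q (toConf d n ⟨x, h1⟩, toConf d m ⟨y, h2⟩) := by
    intro m
    have h3 := ((volume_measurePreserving_sumPiEquivProdPi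
      (fun _ : Fin n ⊕ Fin m => Pos d)).symm).quasiMeasurePreserving.ae
        ((h n m).and (ae_injective hd _))
    have h4 := Measure.ae_ae_of_ae_prod h3
    filter_upwards [h4] with x hx
    filter_upwards [hx] with y hy h1 h2
    exact hy.1 hy.2 h1 h2
  filter_upwards [ae_all_iff.2 h'] with x hx h1
  refine (ae_lebesguePoisson_iff (P := fun b => Q (toConf d n ⟨x, h1⟩, b))
    (measurable_prodMk_left hQ)).2 fun m => ?_
  filter_upwards [hx m] with y hy h2
  exact hy h1 h2

/-- Two independent Lebesgue--Poisson configurations are almost surely disjoint. -/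
theorem ae_ae_disjoint (hd : 1 ≤ d) :
    ∀ᵐ a ∂lebesguePoisson d 1, ∀ᵐ b ∂lebesguePoisson d 1, Disjoint a b := by
  refine ae_ae_lebesguePoisson_of_tuples hd (Q := fun p => Disjoint p.1 p.2)
    measurableSet_disjoint fun n m => .of_forall fun z hz h1 h2 => ?_
  rw [Finset.disjoint_left]
  intro x hx hy
  obtain ⟨i, rfl⟩ := mem_toConf.1 hx
  obtain ⟨j, hj⟩ := mem_toConf.1 hy
  exact Sum.inr_ne_inl (hz hj)

open scoped Classical in
/-- The union of two configurations pushes null sets to null sets. -/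
theorem ae_ae_union (hd : 1 ≤ d) {P : Conf d → Prop} (hP : MeasurableSet {η | P η})
    (h : ∀ᵐ η ∂lebesguePoisson d 1, P η) :
    ∀ᵐ a ∂lebesguePoisson d 1, ∀ᵐ b ∂lebesguePoisson d 1, P (a ∪ b) := by
  refine ae_ae_lebesguePoisson_of_tuples hd (Q := fun p => P (p.1 ∪ p.2))
    (measurable_union hP) fun n m => ?_
  filter_upwards [ae_image_of_ae hd hP h] with z hz _ h1 h2
  convert hz using 1
  ext x
  simp [mem_toConf]


theorem measurableSet_forall_mem {X : Type*} [MeasurableSpace X]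
    {Q : (X × Conf d) × Pos d → Prop} (hQ : MeasurableSet {q | Q q}) :
    MeasurableSet {p : X × Conf d | ∀ x ∈ p.2, Q (p, x)} := by
  refine measurableSet_prod_conf fun n => ?_
  have : {p : X × Tuple d n | (p.1, toConf d n p.2) ∈ {p : X × Conf d | ∀ x ∈ p.2, Q (p, x)}} =
      ⋂ i, {p | Q ((p.1, toConf d n p.2), p.2.1 i)} := by
    ext p
    simp [mem_toConf]
  rw [this]
  refine .iInter fun i => ?_
  have h : Measurable fun p : X × Tuple d n => toConf d n p.2 :=
    (measurable_toConf d n).comp measurable_snd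
  exact ((measurable_fst.prodMk h).prodMk (measurable_tuple_apply measurable_snd i)) hQ

open scoped Classical in
theorem measurableSet_forall_mem_erase {X : Type*} [MeasurableSpace X]
    {Q : X × Conf d → Prop} (hQ : MeasurableSet {q | Q q}) :
    MeasurableSet {p : X × Conf d | ∀ x ∈ p.2, Q (p.1, p.2.erase x)} := by
  refine measurableSet_forall_mem (Q := fun q => Q (q.1.1, q.1.2.erase q.2)) ?_
  exact (measurable_fst.fst.prodMk
    (measurable_erase.comp (measurable_snd.prodMk measurable_fst.snd))) hQ

open scoped Classical in
/-- Removing a point from a configuration preserves properties that hold almost everywhere. -/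
theorem ae_forall_mem_erase (hd : 1 ≤ d) {P : Conf d → Prop} (hP : MeasurableSet {η | P η})
    (h : ∀ᵐ η ∂lebesguePoisson d 1, P η) :
    ∀ᵐ η ∂lebesguePoisson d 1, ∀ x ∈ η, P (η.erase x) := by
  have hmeas : MeasurableSet {η : Conf d | ∀ x ∈ η, P (η.erase x)} :=
    (show Measurable fun η : Conf d => ((), η) by fun_prop)
      (measurableSet_forall_mem_erase (X := Unit) (Q := fun q => P q.2) (measurable_snd hP))
  rw [ae_lebesguePoisson_iff hmeas]
  intro n
  -- Forgetting the i-th coordinate is a projection of a product measure, so preimages of null sets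
  -- are null.
  have h1 : ∀ i, ∀ᵐ x : Fin n → Pos d,
      P (Finset.univ.image fun j : {j : Fin n // j ≠ i} => x j) := by
    intro i
    have h2 := ae_image_of_ae (ι := {j : Fin n // j ≠ i}) hd hP h
    exact ((Measure.quasiMeasurePreserving_fst).comp (volume_preserving_piEquivPiSubtypeProd
      (fun _ : Fin n => Pos d) (fun j => j ≠ i)).quasiMeasurePreserving).ae h2
  filter_upwards [ae_all_iff.2 h1] with x hx hi z hz
  obtain ⟨i, rfl⟩ := mem_toConf.1 hz
  convert hx i using 1
  ext y
  simp only [Finset.mem_erase, mem_toConf, Finset.mem_image, Finset.mem_univ, true_and,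
    Subtype.exists, exists_prop]
  constructor
  · rintro ⟨hy, j, rfl⟩
    exact ⟨j, fun h => hy (h ▸ rfl), rfl⟩
  · rintro ⟨j, hj, rfl⟩
    exact ⟨fun h => hj (hi h), j, rfl⟩

/-! ### Almost sure properties under λ² -/

theorem ae_lambda2_iff {P : Conf2 d → Prop} :
    (∀ᵐ η ∂lambda2 d, P η) ↔ ∀ᵐ p ∂(lebesguePoisson d 1).prod (lebesguePoisson d 1),
      ∀ h : Disjoint p.1 p.2, P ⟨p, h⟩ := by
  have h := ae_restrict_iff_subtype (μ := (lebesguePoisson d 1).prod (lebesguePoisson d 1))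
    (measurableSet_disjoint (d := d)) (p := fun p => ∀ h : Disjoint p.1 p.2, P ⟨p, h⟩)
  rw [ae_restrict_iff' measurableSet_disjoint] at h
  refine Iff.trans ?_ (h.symm.trans ?_)
  · exact ⟨fun h => h.mono fun η hη _ => hη, fun h => h.mono fun η hη => hη η.2⟩
  · exact ⟨fun h => h.mono fun p hp hi => hp hi hi, fun h => h.mono fun p hp _ => hp⟩

/-- An almost sure property on `Γ₀²` contains a measurable property of pairs of configurations. -/
theorem exists_measurable_of_ae_lambda2 {P : Conf2 d → Prop} (h : ∀ᵐ η ∂lambda2 d, P η) :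
    ∃ Q : Conf d × Conf d → Prop, MeasurableSet {p | Q p} ∧
      (∀ᵐ p ∂(lebesguePoisson d 1).prod (lebesguePoisson d 1), Q p) ∧
      ∀ p, Q p → ∀ h : Disjoint p.1 p.2, P ⟨p, h⟩ := by
  obtain ⟨s, hs, hsm, hsQ⟩ := (ae_lambda2_iff.1 h).exists_measurable_mem
  exact ⟨fun p => p ∈ s, hsm, hs, hsQ⟩

open scoped Classical in
/-- Almost sure properties hold for the union of almost all pairs of elements of `Γ₀²`. -/
theorem ae_ae_union_lambda2 (hd : 1 ≤ d) {P : Conf2 d → Prop} (h : ∀ᵐ η ∂lambda2 d, P η) :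
    ∀ᵐ η ∂lambda2 d, ∀ᵐ ξ ∂lambda2 d,
      ∀ h : Disjoint (η.plus ∪ ξ.plus) (η.minus ∪ ξ.minus), P ⟨(_, _), h⟩ := by
  obtain ⟨Q, hQm, hQ, hQP⟩ := exists_measurable_of_ae_lambda2 h
  suffices hs : ∀ᵐ p ∂(lebesguePoisson d 1).prod (lebesguePoisson d 1),
      ∀ᵐ q ∂(lebesguePoisson d 1).prod (lebesguePoisson d 1), Q (p.1 ∪ q.1, p.2 ∪ q.2) by
    refine ae_lambda2_iff.2 (hs.mono fun p hp _ => ae_lambda2_iff.2 (hp.mono fun q hq _ => ?_))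
    exact hQP _ hq
  have hm1 : MeasurableSet {p : (Conf d × Conf d) × Conf d | Q (p.1.1, p.1.2 ∪ p.2)} :=
    (measurable_fst.fst.prodMk
      (measurable_union.comp (measurable_fst.snd.prodMk measurable_snd))) hQm
  have hm2 := measurableSet_ae_right (μ := lebesguePoisson d 1) hm1
  have hm3 := measurableSet_ae_right (μ := lebesguePoisson d 1) hm2
  have h1 : ∀ᵐ a ∂lebesguePoisson d 1, ∀ᵐ b ∂lebesguePoisson d 1,
      ∀ᵐ b' ∂lebesguePoisson d 1, Q (a, b ∪ b') := by
    filter_upwards [Measure.ae_ae_of_ae_prod hQ] with a ha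
    exact ae_ae_union hd (P := fun b => Q (a, b)) (measurable_prodMk_left hQm) ha
  have hm4 : MeasurableSet {p : (Conf d × Conf d) × Conf d × Conf d |
      Q (p.1.1 ∪ p.2.1, p.1.2 ∪ p.2.2)} :=
    ((measurable_union.comp (measurable_fst.fst.prodMk measurable_snd.fst)).prodMk
      (measurable_union.comp (measurable_fst.snd.prodMk measurable_snd.snd))) hQm
  refine (Measure.ae_prod_iff_ae_ae (measurableSet_ae_right hm4)).2 ?_
  filter_upwards [ae_ae_union hd hm3 h1] with a ha
  have hm5 : MeasurableSet {x : Conf d × Conf d |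
      ∀ᵐ b' ∂lebesguePoisson d 1, Q (a ∪ x.1, x.2 ∪ b')} :=
    ((measurable_union.comp (measurable_const.prodMk measurable_fst)).prodMk measurable_snd) hm2
  -- The two componentwise unions give the order a, a', b, b' of quantifiers; moving b before a'
  -- yields the pairs (a, b) and (a', b').
  have ha' := (Measure.ae_ae_comm hm5).1 ha
  filter_upwards [ha'] with b hb
  exact (Measure.ae_prod_iff_ae_ae (measurable_prodMk_left (x := (a, b)) hm4)).2 hb

/-- Almost all pairs of elements of `Γ₀²` are componentwise disjoint. -/
theorem ae_ae_disjoint_lambda2 (hd : 1 ≤ d) :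
    ∀ᵐ η ∂lambda2 d, ∀ᵐ ξ ∂lambda2 d, Disjoint η.plus ξ.plus ∧ Disjoint η.minus ξ.minus := by
  have h1 := Measure.quasiMeasurePreserving_fst (ν := lebesguePoisson d 1) |>.ae
    (ae_ae_disjoint hd)
  have h2 := Measure.quasiMeasurePreserving_snd (μ := lebesguePoisson d 1) |>.ae
    (ae_ae_disjoint hd)
  refine ae_lambda2_iff.2 ?_
  filter_upwards [h1, h2] with p hp1 hp2 _
  refine ae_lambda2_iff.2 ?_
  filter_upwards [Measure.quasiMeasurePreserving_fst (ν := lebesguePoisson d 1) |>.ae hp1,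
    Measure.quasiMeasurePreserving_snd (μ := lebesguePoisson d 1) |>.ae hp2] with q hq1 hq2 _
  exact ⟨hq1, hq2⟩

theorem ae_forall_eraseMinus (hd : 1 ≤ d) {P : Conf2 d → Prop} (h : ∀ᵐ η ∂lambda2 d, P η) :
    ∀ᵐ η ∂lambda2 d, ∀ y ∈ η.minus, P (η.eraseMinus y) := by
  classical
  obtain ⟨Q, hQm, hQ, hQP⟩ := exists_measurable_of_ae_lambda2 h
  have hs : ∀ᵐ p ∂(lebesguePoisson d 1).prod (lebesguePoisson d 1),
      ∀ y ∈ p.2, Q (p.1, p.2.erase y) := by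
    refine (Measure.ae_prod_iff_ae_ae (measurableSet_forall_mem_erase hQm)).2 ?_
    filter_upwards [Measure.ae_ae_of_ae_prod hQ] with a ha
    exact ae_forall_mem_erase hd (P := fun b => Q (a, b)) (measurable_prodMk_left hQm) ha
  exact ae_lambda2_iff.2 (hs.mono fun p hp _ y hy => hQP _ (hp y hy) _)

theorem ae_forall_erasePlus (hd : 1 ≤ d) {P : Conf2 d → Prop} (h : ∀ᵐ η ∂lambda2 d, P η) :
    ∀ᵐ η ∂lambda2 d, ∀ x ∈ η.plus, P (η.erasePlus x) := by
  classical
  obtain ⟨Q, hQm, hQ, hQP⟩ := exists_measurable_of_ae_lambda2 h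
  have hm : MeasurableSet {p : Conf d × Conf d | ∀ x ∈ p.1, Q (p.1.erase x, p.2)} :=
    measurable_swap (measurableSet_forall_mem_erase (measurable_swap hQm))
  have hs : ∀ᵐ p ∂(lebesguePoisson d 1).prod (lebesguePoisson d 1),
      ∀ x ∈ p.1, Q (p.1.erase x, p.2) := by
    -- The minus component is made the outer variable, since the removal acts on the plus component.
    refine (Measure.ae_prod_iff_ae_ae hm).2 ((Measure.ae_ae_comm hm).2 ?_)
    filter_upwards [(Measure.ae_ae_comm hQm).1 (Measure.ae_ae_of_ae_prod hQ)] with b hb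
    exact ae_forall_mem_erase hd (P := fun a => Q (a, b)) (measurable_prodMk_right hQm) hb
  exact ae_lambda2_iff.2 (hs.mono fun p hp _ x hx => hQP _ (hp x hx) _)

/-! ### Evaluation at unions and pairing with kernels -/

theorem size_erasePlus_add_one {η : Conf2 d} {x : Pos d} (hx : x ∈ η.plus) :
    (η.erasePlus x).size + 1 = η.size := by
  classical
  have := Finset.card_erase_add_one hx
  simp only [Conf2.size, Conf2.erasePlus, Conf2.plus, Conf2.minus] at this ⊢
  omega

theorem size_eraseMinus_add_one {η : Conf2 d} {y : Pos d} (hy : y ∈ η.minus) :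
    (η.eraseMinus y).size + 1 = η.size := by
  classical
  have := Finset.card_erase_add_one hy
  simp only [Conf2.size, Conf2.eraseMinus, Conf2.plus, Conf2.minus] at this ⊢
  omega

theorem evalUnion_add (f g : Conf2 d → ℝ) (η ξ : Conf2 d) :
    evalUnion (fun ζ => f ζ + g ζ) η ξ = evalUnion f η ξ + evalUnion g η ξ := by
  unfold evalUnion evalPair
  split_ifs <;> simp

theorem evalUnion_const_mul (c : ℝ) (f : Conf2 d → ℝ) (η ξ : Conf2 d) :
    evalUnion (fun ζ => c * f ζ) η ξ = c * evalUnion f η ξ := by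
  unfold evalUnion evalPair
  split_ifs <;> simp

/-- `∀ᵐ ξ, p η ξ` for almost all `η`, and likewise after removing any one point of `η`. -/
def AEErase (p : Conf2 d → Conf2 d → Prop) (η : Conf2 d) : Prop :=
  (∀ᵐ ξ ∂lambda2 d, p η ξ) ∧
  (∀ x ∈ η.plus, ∀ᵐ ξ ∂lambda2 d, p (η.erasePlus x) ξ) ∧
  ∀ y ∈ η.minus, ∀ᵐ ξ ∂lambda2 d, p (η.eraseMinus y) ξ

theorem ae_AEErase (hd : 1 ≤ d) {p : Conf2 d → Conf2 d → Prop}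
    (h : ∀ᵐ η ∂lambda2 d, ∀ᵐ ξ ∂lambda2 d, p η ξ) : ∀ᵐ η ∂lambda2 d, AEErase p η := by
  filter_upwards [h, ae_forall_erasePlus hd h, ae_forall_eraseMinus hd h] with η h1 h2 h3
  exact ⟨h1, h2, h3⟩

theorem ae_ae_evalUnion_eq (hd : 1 ≤ d) {f g : Conf2 d → ℝ} (h : f =ᵐ[lambda2 d] g) :
    ∀ᵐ η ∂lambda2 d, ∀ᵐ ξ ∂lambda2 d, evalUnion f η ξ = evalUnion g η ξ := by
  filter_upwards [ae_ae_union_lambda2 hd h] with η hη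
  filter_upwards [hη] with ξ hξ
  unfold evalUnion evalPair
  split_ifs with hdisj
  · exact hξ hdisj
  · rfl

/-- For almost all pairs nothing overlaps, so sizes add and the weight factorizes exactly; this
matters for β < 1, where an overlap would enlarge the weight. -/
theorem ae_ae_abs_evalUnion_le (hd : 1 ≤ d) {k : Conf2 d → ℝ} {K β : ℝ} (hK : 0 ≤ K)
    (hβ : 0 ≤ β) (h : ∀ᵐ η ∂lambda2 d, |k η| ≤ K * β ^ η.size) :
    ∀ᵐ η ∂lambda2 d, ∀ᵐ ξ ∂lambda2 d, |evalUnion k η ξ| ≤ K * β ^ η.size * β ^ ξ.size := by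
  classical
  filter_upwards [ae_ae_union_lambda2 hd h, ae_ae_disjoint_lambda2 hd] with η h1 h2
  filter_upwards [h1, h2] with ξ h3 h4
  unfold evalUnion evalPair
  split_ifs with hdisj
  · refine (h3 hdisj).trans_eq ?_
    have : Conf2.size (⟨(η.plus ∪ ξ.plus, η.minus ∪ ξ.minus), hdisj⟩ : Conf2 d) =
        η.size + ξ.size := by
      have e1 := Finset.card_union_of_disjoint h4.1
      have e2 := Finset.card_union_of_disjoint h4.2
      simp only [Conf2.size, Conf2.plus, Conf2.minus] at e1 e2 ⊢
      omega
    rw [this, pow_add, mul_assoc]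
  · rw [abs_zero]; positivity

theorem measurable_pow_size (C : ℝ) : Measurable fun η : Conf2 d => C ^ η.size :=
  (measurable_from_top (f := fun n : ℕ => C ^ n)).comp measurable_size

/-- The pairing of a function of weighted growth `C^{|·|}` with an element of `ℒ_C`. -/
theorem integrable_mul_and_abs_integral_le {C c : ℝ} (hC : 0 ≤ C) {u G : Conf2 d → ℝ}
    (hu : Measurable u) (hG : Measurable G) (hc : ∀ᵐ ξ ∂lambda2 d, |u ξ| ≤ c * C ^ ξ.size)
    (hfin : normL C G ≠ ∞) :
    Integrable (fun ξ => u ξ * G ξ) (lambda2 d) ∧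
      |∫ ξ, u ξ * G ξ ∂lambda2 d| ≤ c * (normL C G).toReal := by
  have hm : Measurable fun ξ : Conf2 d => |G ξ| * C ^ ξ.size :=
    (hG.abs).mul (measurable_pow_size C)
  have hnn : ∀ ξ : Conf2 d, 0 ≤ |G ξ| * C ^ ξ.size := fun ξ => by positivity
  have hint : Integrable (fun ξ => |G ξ| * C ^ ξ.size) (lambda2 d) := by
    refine ⟨hm.aestronglyMeasurable, ?_⟩
    rw [hasFiniteIntegral_iff_ofReal (.of_forall hnn)]
    exact hfin.lt_top
  have hle : ∀ᵐ ξ ∂lambda2 d, ‖u ξ * G ξ‖ ≤ c * (|G ξ| * C ^ ξ.size) := by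
    filter_upwards [hc] with ξ hξ
    rw [norm_mul, Real.norm_eq_abs, Real.norm_eq_abs]
    calc |u ξ| * |G ξ| ≤ c * C ^ ξ.size * |G ξ| := by gcongr
      _ = _ := by ring
  refine ⟨(hint.const_mul c).mono' (hu.mul hG).aestronglyMeasurable hle, ?_⟩
  have h1 := norm_integral_le_of_norm_le (hint.const_mul c) hle
  rw [integral_const_mul, integral_eq_lintegral_of_nonneg_ae (.of_forall hnn)
    hm.aestronglyMeasurable] at h1
  exact h1

theorem measurable_evalUnion_right {k : Conf2 d → ℝ} (hk : Measurable k) (η : Conf2 d) :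
    Measurable fun ξ => evalUnion k η ξ :=
  (measurable_evalUnion (X := Unit) (F := fun _ => k) (hk.comp measurable_snd)).comp
    (f := fun ξ : Conf2 d => ((), η, ξ)) (by fun_prop)

theorem measurable_rateKernel_right {r : Pos d → Conf2 d → ℝ} (hr : IsRate r) (x : Pos d)
    (ζ : Conf2 d) : Measurable (rateKernel r x ζ) :=
  (measurable_rateKernel hr.measurable).comp (f := fun ξ : Conf2 d => (x, ζ, ξ)) (by fun_prop)

/-! ### The formula for L̂* and its pointwise estimate -/

section Operator

variable {dP bP dM bM : Pos d → Conf2 d → ℝ}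

/-- Measurability of each of the four sums in the formula for `L̂*`. -/
theorem measurable_sum_integral {r : Pos d → Conf2 d → ℝ} (hr : IsRate r) {k : Conf2 d → ℝ}
    (hk : Measurable k) {S : Conf2 d → Conf d} (hS : Measurable S)
    {e e' : Conf2 d × Pos d → Conf2 d} (he : Measurable e) (he' : Measurable e') :
    Measurable fun η : Conf2 d => ∑ x ∈ S η,
      ∫ ξ, evalUnion k (e (η, x)) ξ * rateKernel r x (e' (η, x)) ξ ∂lambda2 d := by
  have hG : Measurable fun q : (Conf2 d × Pos d) × Conf2 d =>
      evalUnion k (e q.1) q.2 * rateKernel r q.1.2 (e' q.1) q.2 := by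
    refine Measurable.mul ?_ ?_
    · exact (measurable_evalUnion (X := Unit) (F := fun _ => k) (hk.comp measurable_snd)).comp
        (f := fun q : (Conf2 d × Pos d) × Conf2 d => ((), e q.1, q.2)) (by fun_prop)
    · exact (measurable_rateKernel hr.measurable).comp
        (f := fun q : (Conf2 d × Pos d) × Conf2 d => (q.1.2, e' q.1, q.2)) (by fun_prop)
  have hI : Measurable fun q : Conf2 d × Pos d =>
      ∫ ξ, evalUnion k (e q) ξ * rateKernel r q.2 (e' q) ξ ∂lambda2 d :=
    (hG.stronglyMeasurable.integral_prod_right').measurable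
  exact (measurable_sum_mem hI).comp (f := fun η : Conf2 d => (η, S η)) (by fun_prop)

theorem measurable_LStar (hdP : IsRate dP) (hbP : IsRate bP) (hdM : IsRate dM) (hbM : IsRate bM)
    {k : Conf2 d → ℝ} (hk : Measurable k) : Measurable (LStar dP bP dM bM k) := by
  have m1 := measurable_sum_integral hdP hk measurable_plus measurable_fst measurable_erasePlus
  have m2 := measurable_sum_integral hbP hk measurable_plus measurable_erasePlus
    measurable_erasePlus
  have m3 := measurable_sum_integral hdM hk measurable_minus measurable_fst measurable_eraseMinus
  have m4 := measurable_sum_integral hbM hk measurable_minus measurable_eraseMinus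
    measurable_eraseMinus
  exact ((m1.neg.add m2).sub m3).add m4

theorem LStar_congr {f g : Conf2 d → ℝ} {η : Conf2 d}
    (h : AEErase (fun η ξ => evalUnion f η ξ = evalUnion g η ξ) η) :
    LStar dP bP dM bM f η = LStar dP bP dM bM g η := by
  obtain ⟨h1, h2, h3⟩ := h
  unfold LStar
  congr 1; congr 1; congr 1; congr 1
  all_goals refine Finset.sum_congr rfl fun x hx => integral_congr_ae ?_
  · exact h1.mono fun ξ hξ => by simp only [hξ]
  · exact (h2 x hx).mono fun ξ hξ => by simp only [hξ]
  · exact h1.mono fun ξ hξ => by simp only [hξ]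
  · exact (h3 x hx).mono fun ξ hξ => by simp only [hξ]

theorem LStarDefinedAt_congr {f g : Conf2 d → ℝ} {η : Conf2 d}
    (h : AEErase (fun η ξ => evalUnion f η ξ = evalUnion g η ξ) η)
    (hg : LStarDefinedAt dP bP dM bM g η) : LStarDefinedAt dP bP dM bM f η := by
  obtain ⟨h1, h2, h3⟩ := h
  refine ⟨fun x hx => ⟨(hg.1 x hx).1.congr ?_, (hg.1 x hx).2.congr ?_⟩,
    fun x hx => ⟨(hg.2 x hx).1.congr ?_, (hg.2 x hx).2.congr ?_⟩⟩
  · exact h1.mono fun ξ hξ => by simp only [hξ]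
  · exact (h2 x hx).mono fun ξ hξ => by simp only [hξ]
  · exact h1.mono fun ξ hξ => by simp only [hξ]
  · exact (h3 x hx).mono fun ξ hξ => by simp only [hξ]

theorem LStar_add {f g : Conf2 d → ℝ} {η : Conf2 d} (hf : LStarDefinedAt dP bP dM bM f η)
    (hg : LStarDefinedAt dP bP dM bM g η) :
    LStar dP bP dM bM (fun ζ => f ζ + g ζ) η =
      LStar dP bP dM bM f η + LStar dP bP dM bM g η := by
  unfold LStar
  simp only [evalUnion_add, add_mul]
  rw [Finset.sum_congr rfl fun x hx => integral_add (hf.1 x hx).1 (hg.1 x hx).1,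
    Finset.sum_congr rfl fun x hx => integral_add (hf.1 x hx).2 (hg.1 x hx).2,
    Finset.sum_congr rfl fun x hx => integral_add (hf.2 x hx).1 (hg.2 x hx).1,
    Finset.sum_congr rfl fun x hx => integral_add (hf.2 x hx).2 (hg.2 x hx).2]
  simp only [Finset.sum_add_distrib]
  ring

theorem LStar_const_mul (c : ℝ) (f : Conf2 d → ℝ) (η : Conf2 d) :
    LStar dP bP dM bM (fun ζ => c * f ζ) η = c * LStar dP bP dM bM f η := by
  unfold LStar
  simp only [evalUnion_const_mul, mul_assoc, integral_const_mul, ← Finset.mul_sum]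
  ring

/-- The pointwise estimate of `L̂*k` by the sum of the norms of the kernels. -/
theorem LStarDefinedAt_and_abs_LStar_le (hdP : IsRate dP) (hbP : IsRate bP) (hdM : IsRate dM)
    (hbM : IsRate bM) {C α K : ℝ} (hC : 0 < C) (hα : 0 < α) (hα1 : α ≤ 1) (hK : 0 ≤ K)
    {k : Conf2 d → ℝ} (hk : Measurable k) {η : Conf2 d}
    (h : AEErase (fun η ξ => |evalUnion k η ξ| ≤
      K * (α * C) ^ η.size * (α * C) ^ ξ.size) η)
    (hfin : rateSum C dP bP dM bM η ≠ ∞) :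
    LStarDefinedAt dP bP dM bM k η ∧
      |LStar dP bP dM bM k η| ≤
        K * (α * C) ^ η.size / α * (rateSum C dP bP dM bM η).toReal := by
  obtain ⟨h1, h2, h3⟩ := h
  have hmono : ∀ (ζ ξ : Conf2 d), |evalUnion k ζ ξ| ≤ K * (α * C) ^ ζ.size * (α * C) ^ ξ.size →
      |evalUnion k ζ ξ| ≤ K * (α * C) ^ ζ.size * C ^ ξ.size := fun ζ ξ h => h.trans <| by
    have : α * C ≤ C := mul_le_of_le_one_left hC.le hα1
    gcongr
  -- In [0, ∞] one has 0 · ∞ = 0, so finiteness of the birth sums follows only because their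
  -- coefficient is nonzero.
  have hC' : ENNReal.ofReal (1 / C) ≠ 0 := by simpa using hC
  unfold rateSum at hfin ⊢
  simp only [ne_eq, ENNReal.add_eq_top, ENNReal.mul_eq_top, not_or, not_and,
    ENNReal.sum_eq_top, ENNReal.ofReal_ne_top, false_and, not_false_eq_true, and_true,
    not_exists] at hfin
  obtain ⟨⟨⟨fdP, fbP⟩, fdM⟩, fbM⟩ := hfin
  replace fbP := fbP hC'
  replace fbM := fbM hC'
  have i1 : ∀ x ∈ η.plus, _ := fun x hx => integrable_mul_and_abs_integral_le hC.le
    (measurable_evalUnion_right hk η) (measurable_rateKernel_right hdP x (η.erasePlus x))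
    (h1.mono fun ξ => hmono η ξ) (fdP x hx)
  have i2 : ∀ x ∈ η.plus, _ := fun x hx => integrable_mul_and_abs_integral_le hC.le
    (measurable_evalUnion_right hk (η.erasePlus x))
    (measurable_rateKernel_right hbP x (η.erasePlus x))
    ((h2 x hx).mono fun ξ => hmono _ ξ) (fbP x hx)
  have i3 : ∀ x ∈ η.minus, _ := fun x hx => integrable_mul_and_abs_integral_le hC.le
    (measurable_evalUnion_right hk η) (measurable_rateKernel_right hdM x (η.eraseMinus x))
    (h1.mono fun ξ => hmono η ξ) (fdM x hx)
  have i4 : ∀ x ∈ η.minus, _ := fun x hx => integrable_mul_and_abs_integral_le hC.le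
    (measurable_evalUnion_right hk (η.eraseMinus x))
    (measurable_rateKernel_right hbM x (η.eraseMinus x))
    ((h3 x hx).mono fun ξ => hmono _ ξ) (fbM x hx)
  refine ⟨⟨fun x hx => ⟨(i1 x hx).1, (i2 x hx).1⟩, fun x hx => ⟨(i3 x hx).1, (i4 x hx).1⟩⟩, ?_⟩
  set b := K * (α * C) ^ η.size with hb
  have hb0 : 0 ≤ b := by positivity
  -- The death terms do not need 1/α; they are enlarged to share the prefactor of the birth terms.
  have hbα : b ≤ b / α := le_div_self hb0 hα hα1
  -- The removed point costs 1/(αC), whose part 1/C is the weight of the birth kernels in `rateSum`.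
  have herase : ∀ n, n + 1 = η.size → K * (α * C) ^ n = b / α * (1 / C) := by
    intro n hn
    rw [hb, ← hn, pow_succ]
    field_simp
  have s1 : |∑ x ∈ η.plus, ∫ ξ, evalUnion k η ξ * rateKernel dP x (η.erasePlus x) ξ ∂lambda2 d|
      ≤ b / α * ∑ x ∈ η.plus, (normL C (rateKernel dP x (η.erasePlus x))).toReal := by
    rw [Finset.mul_sum]
    refine (Finset.abs_sum_le_sum_abs _ _).trans (Finset.sum_le_sum fun x hx => ?_)
    exact (i1 x hx).2.trans (by gcongr)
  have s2 : |∑ x ∈ η.plus, ∫ ξ, evalUnion k (η.erasePlus x) ξ *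
      rateKernel bP x (η.erasePlus x) ξ ∂lambda2 d| ≤ b / α * (1 / C) *
        ∑ x ∈ η.plus, (normL C (rateKernel bP x (η.erasePlus x))).toReal := by
    rw [Finset.mul_sum]
    refine (Finset.abs_sum_le_sum_abs _ _).trans (Finset.sum_le_sum fun x hx => ?_)
    rw [← herase _ (size_erasePlus_add_one hx)]
    exact (i2 x hx).2
  have s3 : |∑ x ∈ η.minus, ∫ ξ, evalUnion k η ξ * rateKernel dM x (η.eraseMinus x) ξ ∂lambda2 d|
      ≤ b / α * ∑ x ∈ η.minus, (normL C (rateKernel dM x (η.eraseMinus x))).toReal := by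
    rw [Finset.mul_sum]
    refine (Finset.abs_sum_le_sum_abs _ _).trans (Finset.sum_le_sum fun x hx => ?_)
    exact (i3 x hx).2.trans (by gcongr)
  have s4 : |∑ x ∈ η.minus, ∫ ξ, evalUnion k (η.eraseMinus x) ξ *
      rateKernel bM x (η.eraseMinus x) ξ ∂lambda2 d| ≤ b / α * (1 / C) *
        ∑ x ∈ η.minus, (normL C (rateKernel bM x (η.eraseMinus x))).toReal := by
    rw [Finset.mul_sum]
    refine (Finset.abs_sum_le_sum_abs _ _).trans (Finset.sum_le_sum fun x hx => ?_)
    rw [← herase _ (size_eraseMinus_add_one hx)]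
    exact (i4 x hx).2
  have t1 := ENNReal.sum_ne_top.2 fdP
  have t2 := ENNReal.mul_ne_top (ENNReal.ofReal_ne_top (r := 1 / C)) (ENNReal.sum_ne_top.2 fbP)
  have t3 := ENNReal.sum_ne_top.2 fdM
  have t4 := ENNReal.mul_ne_top (ENNReal.ofReal_ne_top (r := 1 / C)) (ENNReal.sum_ne_top.2 fbM)
  rw [ENNReal.toReal_add (ENNReal.add_ne_top.2 ⟨ENNReal.add_ne_top.2 ⟨t1, t2⟩, t3⟩) t4,
    ENNReal.toReal_add (ENNReal.add_ne_top.2 ⟨t1, t2⟩) t3,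
    ENNReal.toReal_add t1 t2, ENNReal.toReal_mul, ENNReal.toReal_mul,
    ENNReal.toReal_ofReal (by positivity), ENNReal.toReal_sum fdP, ENNReal.toReal_sum fbP,
    ENNReal.toReal_sum fdM, ENNReal.toReal_sum fbM]
  unfold LStar
  rw [abs_le] at s1 s2 s3 s4 ⊢
  constructor <;> linarith [s1.1, s1.2, s2.1, s2.2, s3.1, s3.2, s4.1, s4.2]

end Operator

/-! ### The scalar optimization -/

/-- The maximum of `t ↦ t^M q^t`. -/
theorem pow_mul_rpow_le {q t : ℝ} (hq0 : 0 < q) (hq1 : q < 1) (ht : 0 ≤ t) (M : ℕ) :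
    t ^ M * q ^ t ≤ ((M : ℝ) / (-(Real.exp 1 * Real.log q))) ^ M := by
  rcases Nat.eq_zero_or_pos M with rfl | hM
  · simpa using Real.rpow_le_one hq0.le hq1.le ht
  have hM' : (0 : ℝ) < M := by exact_mod_cast hM
  have hlog : 0 < -Real.log q := neg_pos.2 (Real.log_neg hq0 hq1)
  set c := -Real.log q with hc
  -- Taking M-th roots (M = 0 was separate, as M is a divisor here) leaves s·e^(-s) ≤ 1/e for s =
  -- ct/M, which is 1 + u ≤ e^u at u = s - 1.
  have hqt : q ^ t = Real.exp (-(c * t / M)) ^ M := by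
    rw [← Real.exp_nat_mul, Real.rpow_def_of_pos hq0]
    congr 1
    rw [hc]
    field_simp
  rw [hqt, ← mul_pow]
  refine pow_le_pow_left₀ (by positivity) ?_ M
  have h1 := Real.add_one_le_exp (c * t / M - 1)
  rw [sub_add_cancel] at h1
  have h2 : -(Real.exp 1 * Real.log q) = Real.exp 1 * c := by rw [hc]; ring
  rw [h2, le_div_iff₀ (by positivity)]
  have h3 : Real.exp (-(c * t / M)) * Real.exp 1 * Real.exp (c * t / M - 1) = 1 := by
    rw [← Real.exp_add, ← Real.exp_add, ← Real.exp_zero]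
    congr 1; ring
  have h4 : t * c = M * (c * t / M) := by field_simp
  calc t * Real.exp (-(c * t / M)) * (Real.exp 1 * c)
      = M * (Real.exp (-(c * t / M)) * Real.exp 1 * (c * t / M)) := by
        linear_combination (Real.exp (-(c * t / M)) * Real.exp 1) * h4
    _ ≤ M * (Real.exp (-(c * t / M)) * Real.exp 1 * Real.exp (c * t / M - 1)) := by gcongr
    _ = M := by rw [h3, mul_one]

/-- The maximum is used at t = n + 1; the missing factor of q is the origin of 1/(αν) in the final
constant. -/
theorem one_add_pow_mul_pow_le {q : ℝ} (hq0 : 0 < q) (hq1 : q < 1) (M n : ℕ) :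
    (1 + (n : ℝ)) ^ M * q ^ n ≤
      1 / q * ((M : ℝ) / (-(Real.exp 1 * Real.log q))) ^ M := by
  have h := pow_mul_rpow_le hq0 hq1 (t := ((n + 1 : ℕ) : ℝ)) (by positivity) M
  rw [Real.rpow_natCast, pow_succ] at h
  push_cast at h
  rw [one_div, inv_mul_eq_div, le_div_iff₀ hq0, add_comm 1 (n : ℝ)]
  linarith

/-! ### The spaces 𝒦_C and the norm bound -/

theorem KSpace_mul_le {α C : ℝ} (hα0 : 0 < α) (hα1 : α ≤ 1) (hC : 0 < C) :
    KSpace d (α * C) ≤ KSpace d C := by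
  intro k hk
  have hk' : MemLp (weighted (α * C) k) ∞ (lambda2 d) := hk
  change MemLp (weighted C k) ∞ (lambda2 d)
  refine hk'.of_le ?_ (.of_forall fun η => ?_)
  · exact ((measurable_pow_size C).inv.mul k.measurable).aestronglyMeasurable
  · unfold weighted
    rw [norm_mul, norm_mul, norm_inv, norm_inv,
      Real.norm_of_nonneg (pow_nonneg hC.le _),
      Real.norm_of_nonneg (pow_nonneg (mul_pos hα0 hC).le _)]
    have : α * C ≤ C := mul_le_of_le_one_left hC.le hα1
    gcongr

theorem normK_nonneg {C : ℝ} (k : KSpace d C) : 0 ≤ normK k := ENNReal.toReal_nonneg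

theorem ae_abs_le_normK {C : ℝ} (hC : 0 < C) (k : KSpace d C) :
    ∀ᵐ η ∂lambda2 d, |(k : Conf2 d →ₘ[lambda2 d] ℝ) η| ≤ normK k * C ^ η.size := by
  have hk : MemLp (weighted C (k : Conf2 d →ₘ[lambda2 d] ℝ)) ∞ (lambda2 d) := k.2
  filter_upwards [ae_le_eLpNormEssSup
    (f := weighted C (k : Conf2 d →ₘ[lambda2 d] ℝ)) (μ := lambda2 d)] with η hη
  rw [← eLpNorm_exponent_top] at hη
  -- Membership in 𝒦_C keeps the essential supremum finite; otherwise `toReal` would turn it into 0.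
  have h := ENNReal.toReal_mono hk.2.ne hη
  rw [toReal_enorm] at h
  unfold weighted at h
  rw [norm_mul, norm_inv, Real.norm_of_nonneg (by positivity), Real.norm_eq_abs,
    inv_mul_le_iff₀ (by positivity), mul_comm] at h
  exact h

theorem memLp_weighted_and_eLpNorm_le {C B : ℝ} (hB : 0 ≤ B) {f : Conf2 d → ℝ}
    (hf : AEStronglyMeasurable f (lambda2 d))
    (h : ∀ᵐ η ∂lambda2 d, ‖weighted C f η‖ ≤ B) :
    MemLp (weighted C f) ∞ (lambda2 d) ∧
      (eLpNorm (weighted C f) ∞ (lambda2 d)).toReal ≤ B := by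
  have hle : eLpNorm (weighted C f) ∞ (lambda2 d) ≤ ENNReal.ofReal B :=
    eLpNorm_exponent_top (f := weighted C f) ▸ eLpNormEssSup_le_of_ae_bound h
  refine ⟨⟨?_, hle.trans_lt ENNReal.ofReal_lt_top⟩, ENNReal.toReal_le_of_le_ofReal hB hle⟩
  exact (measurable_pow_size C).inv.aestronglyMeasurable.mul hf

/-- For `k ∈ 𝒦_{αC}` the formula for `L̂*k` is defined almost everywhere, with the asserted
bound. -/
theorem ae_LStarDefinedAt_and_weighted_le (hd : 1 ≤ d) {dP bP dM bM : Pos d → Conf2 d → ℝ}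
    (hdP : IsRate dP) (hbP : IsRate bP) (hdM : IsRate dM) (hbM : IsRate bM)
    {C : ℝ} (hC : 0 < C) {N : Conf2 d → ℝ}
    (hN_bdd : ∀ᵐ η ∂lambda2 d, 0 ≤ N η ∧ rateSum C dP bP dM bM η ≤ ENNReal.ofReal (N η))
    {A : ℝ} (hA : 0 ≤ A) {M : ℕ} {ν : ℝ} (hν : 1 ≤ ν)
    (hN_growth : ∀ η : Conf2 d, N η ≤ A * (1 + (η.size : ℝ)) ^ M * ν ^ η.size)
    {α : ℝ} (hα0 : 0 < α) (hα1 : α < 1 / ν) (k : KSpace d (α * C)) :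
    ∀ᵐ η ∂lambda2 d, LStarDefinedAt dP bP dM bM (k : Conf2 d →ₘ[lambda2 d] ℝ) η ∧
      ‖weighted C (LStar dP bP dM bM (k : Conf2 d →ₘ[lambda2 d] ℝ)) η‖ ≤
        A / α * (1 / (α * ν)) * ((M : ℝ) / (-(Real.exp 1 * Real.log (α * ν)))) ^ M *
          normK k := by
  have hν0 : 0 < ν := by linarith
  have hαν : α * ν < 1 := (lt_div_iff₀ hν0).1 hα1
  have hα1' : α ≤ 1 := hα1.le.trans (div_le_one_of_le₀ hν hν0.le)
  have hK := normK_nonneg k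
  have hb := ae_ae_abs_evalUnion_le hd hK (by positivity) (ae_abs_le_normK (by positivity) k)
  filter_upwards [ae_AEErase hd hb, hN_bdd] with η hη hN
  have hfin := ne_top_of_le_ne_top ENNReal.ofReal_ne_top hN.2
  obtain ⟨h1, h2⟩ := LStarDefinedAt_and_abs_LStar_le hdP hbP hdM hbM hC hα0 hα1' hK
    (k : Conf2 d →ₘ[lambda2 d] ℝ).measurable hη hfin
  refine ⟨h1, ?_⟩
  have h3 : (rateSum C dP bP dM bM η).toReal ≤ N η := ENNReal.toReal_le_of_le_ofReal hN.1 hN.2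
  unfold weighted
  rw [norm_mul, norm_inv, Real.norm_of_nonneg (by positivity), Real.norm_eq_abs,
    inv_mul_le_iff₀ (by positivity)]
  have h4 := one_add_pow_mul_pow_le (mul_pos hα0 hν0) hαν M η.size
  calc |LStar dP bP dM bM (k : Conf2 d →ₘ[lambda2 d] ℝ) η|
      ≤ normK k * (α * C) ^ η.size / α * (rateSum C dP bP dM bM η).toReal := h2
    _ ≤ normK k * (α * C) ^ η.size / α * (A * (1 + (η.size : ℝ)) ^ M * ν ^ η.size) := by
        gcongr
        exact h3.trans (hN_growth η)
    _ = C ^ η.size * (A / α * ((1 + (η.size : ℝ)) ^ M * (α * ν) ^ η.size) * normK k) := by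
        rw [mul_pow, mul_pow]; ring
    _ ≤ C ^ η.size * (A / α * (1 / (α * ν) *
          ((M : ℝ) / (-(Real.exp 1 * Real.log (α * ν)))) ^ M) * normK k) := by gcongr
    _ = _ := by ring

/-! ### The operator on classes and the theorem -/

/-- The `λ²`-class of `L̂*k`. -/
def LStarClass {dP bP dM bM : Pos d → Conf2 d → ℝ}
    (hdP : IsRate dP) (hbP : IsRate bP) (hdM : IsRate dM) (hbM : IsRate bM)
    (k : Conf2 d →ₘ[lambda2 d] ℝ) : Conf2 d →ₘ[lambda2 d] ℝ :=
  AEEqFun.mk (LStar dP bP dM bM k)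
    (measurable_LStar hdP hbP hdM hbM k.measurable).aestronglyMeasurable

theorem coeFn_LStarClass {dP bP dM bM : Pos d → Conf2 d → ℝ}
    (hdP : IsRate dP) (hbP : IsRate bP) (hdM : IsRate dM) (hbM : IsRate bM)
    (k : Conf2 d →ₘ[lambda2 d] ℝ) :
    LStarClass hdP hbP hdM hbM k =ᵐ[lambda2 d] LStar dP bP dM bM k :=
  AEEqFun.coeFn_mk _ _

/-- The operator `L̂*` on the domain `𝒦_β ∩ 𝒦_C`, for rates for which the formula for `L̂*k` is
almost everywhere defined and in `𝒦_C` for all `k ∈ 𝒦_β`. -/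
def LStarPMap (hd : 1 ≤ d) {dP bP dM bM : Pos d → Conf2 d → ℝ}
    (hdP : IsRate dP) (hbP : IsRate bP) (hdM : IsRate dM) (hbM : IsRate bM) (β C : ℝ)
    (hdef : ∀ k ∈ KSpace d β, ∀ᵐ η ∂lambda2 d, LStarDefinedAt dP bP dM bM k η)
    (hmem : ∀ k ∈ KSpace d β, LStarClass hdP hbP hdM hbM k ∈ KSpace d C) :
    KSpace d C →ₗ.[ℝ] KSpace d C where
  domain := (KSpace d β).comap (KSpace d C).subtype
  toFun :=
    { toFun := fun k => ⟨LStarClass hdP hbP hdM hbM (k : KSpace d C), hmem _ k.2⟩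
      map_add' := fun k l => by
        refine Subtype.ext (AEEqFun.ext ?_)
        refine (coeFn_LStarClass hdP hbP hdM hbM _).trans (.trans ?_ (AEEqFun.coeFn_add _ _).symm)
        filter_upwards [coeFn_LStarClass hdP hbP hdM hbM (k : KSpace d C),
          coeFn_LStarClass hdP hbP hdM hbM (l : KSpace d C),
          -- The representative of k + l is only almost everywhere the sum of the representatives,
          -- so additivity passes through congruence at unions.
          ae_AEErase hd (ae_ae_evalUnion_eq hd (AEEqFun.coeFn_add
            ((k : KSpace d C) : Conf2 d →ₘ[lambda2 d] ℝ) (l : KSpace d C))),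
          hdef (k : KSpace d C) k.2, hdef (l : KSpace d C) l.2] with η h1 h2 h3 h4 h5
        rw [Pi.add_apply, h1, h2, ← LStar_add h4 h5]
        exact LStar_congr h3
      map_smul' := fun c k => by
        refine Subtype.ext (AEEqFun.ext ?_)
        refine (coeFn_LStarClass hdP hbP hdM hbM _).trans (.trans ?_ (AEEqFun.coeFn_smul _ _).symm)
        filter_upwards [coeFn_LStarClass hdP hbP hdM hbM (k : KSpace d C),
          ae_AEErase hd (ae_ae_evalUnion_eq hd (AEEqFun.coeFn_smul c
            ((k : KSpace d C) : Conf2 d →ₘ[lambda2 d] ℝ)))] with η h1 h3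
        rw [Pi.smul_apply, RingHom.id_apply, h1, smul_eq_mul, ← LStar_const_mul]
        exact LStar_congr h3 }

end TwoComp

end

theorem mainTheorem4 (d : ℕ) (hd : 1 ≤ d)
    (dP bP dM bM : TwoComp.Pos d → TwoComp.Conf2 d → ℝ)
    (hdP : TwoComp.IsRate dP) (hbP : TwoComp.IsRate bP)
    (hdM : TwoComp.IsRate dM) (hbM : TwoComp.IsRate bM)
    (C : ℝ) (hC : 0 < C) (N : TwoComp.Conf2 d → ℝ)
    (hN_int : ∀ n m : ℕ, 1 ≤ n → 1 ≤ m → ∀ Λ : Set (TwoComp.Pos d),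
      MeasurableSet Λ → Bornology.IsBounded Λ →
        IntegrableOn N (TwoComp.confIn Λ n m) (TwoComp.lambda2 d))
    (hN_bdd : ∀ᵐ η ∂(TwoComp.lambda2 d),
      0 ≤ N η ∧ TwoComp.rateSum C dP bP dM bM η ≤ ENNReal.ofReal (N η))
    (A : ℝ) (hA : 0 < A) (M : ℕ) (ν : ℝ) (hν : 1 ≤ ν)
    (hN_growth : ∀ η : TwoComp.Conf2 d, N η ≤ A * (1 + (η.size : ℝ)) ^ M * ν ^ η.size)
    (α : ℝ) (hα0 : 0 < α) (hα1 : α < 1 / ν) :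
    TwoComp.KSpace d (α * C) ≤ TwoComp.KSpace d C ∧
    ∃ T : TwoComp.KSpace d C →ₗ.[ℝ] TwoComp.KSpace d C,
      T.domain = (TwoComp.KSpace d (α * C)).comap (TwoComp.KSpace d C).subtype ∧
      ∀ (k : T.domain) (hk : ((k : TwoComp.KSpace d C) :
            TwoComp.Conf2 d →ₘ[TwoComp.lambda2 d] ℝ) ∈ TwoComp.KSpace d (α * C)),
        (∀ f : TwoComp.Conf2 d → ℝ,
          f =ᵐ[TwoComp.lambda2 d] ((k : TwoComp.KSpace d C) :
            TwoComp.Conf2 d →ₘ[TwoComp.lambda2 d] ℝ) →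
          (∀ᵐ η ∂(TwoComp.lambda2 d), TwoComp.LStarDefinedAt dP bP dM bM f η) ∧
          ((T k : TwoComp.KSpace d C) : TwoComp.Conf2 d →ₘ[TwoComp.lambda2 d] ℝ)
            =ᵐ[TwoComp.lambda2 d] TwoComp.LStar dP bP dM bM f) ∧
        TwoComp.normK (T k) ≤
          A / α * (1 / (α * ν)) * ((M : ℝ) / (-(Real.exp 1 * Real.log (α * ν)))) ^ M *
            TwoComp.normK (⟨_, hk⟩ : TwoComp.KSpace d (α * C)) := by
  open TwoComp in
  have hν0 : 0 < ν := by linarith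
  have hαν : α * ν < 1 := (lt_div_iff₀ hν0).1 hα1
  have hα1' : α ≤ 1 := hα1.le.trans (div_le_one_of_le₀ hν hν0.le)
  have key := ae_LStarDefinedAt_and_weighted_le hd hdP hbP hdM hbM hC hN_bdd hA.le hν hN_growth
    hα0 hα1
  have hlog : 0 < -(Real.exp 1 * Real.log (α * ν)) := by
    have := mul_pos (Real.exp_pos 1) (neg_pos.2 (Real.log_neg (by positivity) hαν))
    linarith
  have hB : 0 ≤ A / α * (1 / (α * ν)) *
      ((M : ℝ) / (-(Real.exp 1 * Real.log (α * ν)))) ^ M := by positivity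
  have hT : ∀ (k : Conf2 d →ₘ[lambda2 d] ℝ) (hk : k ∈ KSpace d (α * C)),
      MemLp (weighted C (LStarClass hdP hbP hdM hbM k)) ∞ (lambda2 d) ∧
        (eLpNorm (weighted C (LStarClass hdP hbP hdM hbM k)) ∞ (lambda2 d)).toReal ≤
          A / α * (1 / (α * ν)) * ((M : ℝ) / (-(Real.exp 1 * Real.log (α * ν)))) ^ M *
            normK (⟨k, hk⟩ : KSpace d (α * C)) := fun k hk =>
    memLp_weighted_and_eLpNorm_le (mul_nonneg hB (normK_nonneg ⟨k, hk⟩))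
      (LStarClass hdP hbP hdM hbM k).aestronglyMeasurable
      (by
        filter_upwards [key ⟨k, hk⟩, coeFn_LStarClass hdP hbP hdM hbM k] with η h1 h2
        unfold weighted at h1 ⊢
        rw [h2]
        exact h1.2)
  refine ⟨KSpace_mul_le hα0 hα1' hC, LStarPMap hd hdP hbP hdM hbM (α * C) C
    (fun k hk => (key ⟨k, hk⟩).mono fun η h => h.1) (fun k hk => (hT k hk).1), rfl,
    fun k hk => ⟨fun f hf => ?_, (hT _ hk).2⟩⟩
  -- An arbitrary representative f agrees with the chosen one at almost all unions, also after a
  -- point is removed; definedness and value carry over.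
  have hcongr := ae_AEErase hd (ae_ae_evalUnion_eq hd hf)
  constructor
  · filter_upwards [hcongr, key ⟨_, hk⟩] with η h1 h2
    exact LStarDefinedAt_congr h1 h2.1
  · filter_upwards [hcongr, coeFn_LStarClass hdP hbP hdM hbM (k : KSpace d C)] with η h1 h2
    exact h2.trans (LStar_congr h1).symm
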